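/- Let $L\subset S^3$ be a non-empty oriented link with $c(L)$ components. Let $V_L\in\mathbb{Z}[t^{\pm 1/2}]$ be its Jones polynomial, normalized by $V=1$ for the unknot and satisfying $$t^{-1}V_{L_+}(t)-t\,V_{L_-}(t)=(t^{1/2}-t^{-1/2})\,V_{L_0}(t)$$ (equivalently, given by Kauffman's state sum of any diagram of $L$). Let $A$ be any $n\times n$ Seifert matrix of $L$, i.e. a matrix of the form $(\beta,\gamma)\mapsto\mathrm{lk}(\beta,\gamma^+)$ on the first homology of a connected Seifert surface of $L$, or any matrix S-equivalent to such a matrix, and let $M=A+A^{\top}$. Let $\sigma(L)$ be the number of positive eigenvalues minus the number of negative eigenvalues of $M$ (with multiplicity), let $\det(L)=|\det M|$, and let $$\Delta_L(t)=\det\bigl(-t^{1/2}A+t^{-1/2}A^{\top}\bigr)\in\mathbb{Z}[t^{\pm 1/2}]$$ be the Alexander polynomial in the Conway normalization (the determinant of the empty matrix being $1$). Values at $t=-1$ are taken with $t^{1/2}=i$. Then $$V_L(-1)=i^{\sigma(L)}\det(L),\qquad \Delta_L(-1)=i^{-\sigma(L)}\det(L),\qquad V_L(-1)=(-1)^{c(L)-1}\Delta_L(-1).$$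 -/

import Mathlib

/-! Oriented links are presented by oriented link diagrams on the sphere (up to homeomorphism of the
sphere), i.e. by plane oriented 4-valent graphs with a choice of over- and undercrossings. -/

/-- The two sides on which a strand can lie at a crossing. Every crossing is looked at so that both
of its strands run upward: there are a left and a right incoming arc (below) and a left and a right
outgoing arc (above). The two strands run from lower left to upper right, and from lower right to
upper left. -/
inductive Side : Type
  | left
  | right
  deriving DecidableEq

instance Side.instFintype : Fintype Side where
  elems := {.left, .right}
  complete := by intro s; cases s <;> simp

/-- An oriented 4-valent graph with `n` vertices, each of which is a transverse crossing of two
strands. An arc is named by the place where it starts: `(c, s)` is the arc that leaves the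
crossing `c` on the side `s`, and it ends at the crossing `(next (c, s)).1`, on the side
`(next (c, s)).2`. -/
structure LinkShadow where
  n : ℕ
  next : Equiv.Perm (Fin n × Side)

namespace LinkShadow

/-- The arcs, that is, the edges of the 4-valent graph. -/
abbrev Arc (S : LinkShadow) : Type := Fin S.n × Side

/-- The arc that leaves the crossing `c` on the side `s`. -/
def outArc (S : LinkShadow) (c : Fin S.n) (s : Side) : S.Arc := (c, s)

/-- The arc that arrives at the crossing `c` on the side `s`. -/
def inArc (S : LinkShadow) (c : Fin S.n) (s : Side) : S.Arc := S.next.symm (c, s)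

/-- Adjacency of the arcs that meet at a crossing. -/
inductive Meet (S : LinkShadow) : S.Arc → S.Arc → Prop
  | across (c : Fin S.n) (s s' : Side) : Meet S (S.inArc c s) (S.outArc c s')
  | below (c : Fin S.n) : Meet S (S.inArc c .left) (S.inArc c .right)

/-- The number of connected components of the 4-valent graph. -/
noncomputable def graphPieces (S : LinkShadow) : ℕ := Nat.card (Quot S.Meet)

/-- Every arc has a left and a right border (with respect to its orientation). At each
crossing, every one of the four sectors (upper, right, lower, left) joins the borders of the two
arcs that bound this sector. -/
inductive Corner (S : LinkShadow) : S.Arc × Side → S.Arc × Side → Prop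
  | upper (c : Fin S.n) : Corner S (S.outArc c .right, .left) (S.outArc c .left, .right)
  | right (c : Fin S.n) : Corner S (S.inArc c .right, .right) (S.outArc c .right, .right)
  | lower (c : Fin S.n) : Corner S (S.inArc c .right, .left) (S.inArc c .left, .right)
  | left (c : Fin S.n) : Corner S (S.inArc c .left, .left) (S.outArc c .left, .left)

/-- The number of faces of the closed oriented surface that is obtained by gluing a disk to each
boundary circuit of the thickened graph. -/
noncomputable def faces (S : LinkShadow) : ℕ := Nat.card (Quot S.Corner)

/-- Planarity, through the Euler characteristic: there are `n` vertices and `2 * n` edges, and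
`n - 2 * n + faces = 2 * graphPieces` means that each connected component of the graph is drawn
on a sphere. -/
def IsPlanar (S : LinkShadow) : Prop := S.faces = S.n + 2 * S.graphPieces

end LinkShadow

/-- A diagram of a non-empty oriented link. The disjoint pieces of a diagram
are split from each other, so that their relative position is immaterial for the link. -/
structure LinkDiagram extends LinkShadow where
  /-- `true` for a positive crossing (the strand from lower left to upper right is the
  overstrand), `false` for a negative one (that strand is the understrand). -/
  positive : Fin n → Bool
  /-- The number of further circles, without any crossing. -/
  circles : ℕ
  planar : toLinkShadow.IsPlanar
  nonempty : 0 < n + circles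

namespace LinkDiagram

/-! ### Components and the Jones polynomial -/

/-- Going straight through a crossing: from one side to the other. -/
inductive Straight (D : LinkDiagram) : D.Arc → D.Arc → Prop
  | toRight (c : Fin D.n) : Straight D (D.inArc c .left) (D.outArc c .right)
  | toLeft (c : Fin D.n) : Straight D (D.inArc c .right) (D.outArc c .left)

/-- The number `c(L)` of components of the link. -/
noncomputable def components (D : LinkDiagram) : ℕ := Nat.card (Quot D.Straight) + D.circles

/-- A state chooses a smoothing of every crossing: `true` stands for the `A`-smoothing (which opens
a channel between the two regions swept out by the overstrand when it is turned counterclockwise)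
and `false` for the `B`-smoothing. So the `A`-smoothing of a positive crossing and the
`B`-smoothing of a negative one are those that respect the orientation, and join each incoming arc
to the outgoing arc on the same side. The others join left with right. -/
inductive Smoothing (D : LinkDiagram) (s : Fin D.n → Bool) : D.Arc → D.Arc → Prop
  | oriented (c : Fin D.n) (side : Side) (h : s c = D.positive c) :
      Smoothing D s (D.inArc c side) (D.outArc c side)
  | lower (c : Fin D.n) (h : s c ≠ D.positive c) :
      Smoothing D s (D.inArc c .left) (D.inArc c .right)
  | upper (c : Fin D.n) (h : s c ≠ D.positive c) :
      Smoothing D s (D.outArc c .left) (D.outArc c .right)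

/-- The number of circles of the smoothed diagram. -/
noncomputable def loops (D : LinkDiagram) (s : Fin D.n → Bool) : ℕ :=
  Nat.card (Quot (D.Smoothing s)) + D.circles

/-- The number of positive crossings. -/
def numPos (D : LinkDiagram) : ℕ := (Finset.univ.filter fun c => D.positive c = true).card

/-- The number of negative crossings. -/
def numNeg (D : LinkDiagram) : ℕ := (Finset.univ.filter fun c => D.positive c = false).card

/-- The number of `B`-smoothings in a state. -/
def numB (D : LinkDiagram) (s : Fin D.n → Bool) : ℕ :=
  (Finset.univ.filter fun c => s c = false).card

open LaurentPolynomial in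
/-- The Jones polynomial, as a Laurent polynomial in `q = t ^ (1 / 2)`, by Kauffman's state sum.
With `w = numPos - numNeg` and `t = A ^ (-4)`, so `q = A ^ (-2)`, it is the polynomial
`(- A ^ 3) ^ (- w) * ∑ s, A ^ (n - 2 * numB s) * (- A ^ 2 - A ^ (-2)) ^ (loops s - 1)`.
It is `1` for the unknot and has
`q ^ (-2) * V (L₊) - q ^ 2 * V (L₋) = (q - q ^ (-1)) * V (L₀)`. -/
noncomputable def jones (D : LinkDiagram) : LaurentPolynomial ℤ :=
  (-1) ^ (D.numPos + D.numNeg) * T ((D.numPos : ℤ) - 2 * (D.numNeg : ℤ)) *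
    ∑ s : Fin D.n → Bool, T (D.numB s : ℤ) * (-T 1 - T (-1)) ^ (D.loops s - 1)

/-! ### The Seifert surface of a diagram and its Seifert form

Smoothing all crossings along the orientation gives the Seifert circles. They bound disjoint disks
in the upper half of the 3-sphere, one for each circle. Joining these at every crossing by a
half-twisted band gives the surface `F`. The crossing band leads from the left to the right strand
of the smoothed crossing. -/

/-- The 1-cycles on the 4-valent graph. Such a cycle is also a cycle on `F`: it follows the Seifert
circles along the arcs, and runs through the band at each crossing with the multiplicity that
the conservation of flow dictates. -/
def cycles (D : LinkDiagram) : Submodule ℤ (D.Arc → ℤ) where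
  carrier := {x | ∀ c, x (D.inArc c .left) + x (D.inArc c .right) =
    x (D.outArc c .left) + x (D.outArc c .right)}
  add_mem' := by
    intro x y hx hy c
    have h1 := hx c
    have h2 := hy c
    simp only [Pi.add_apply]
    linarith
  zero_mem' := by intro c; simp
  smul_mem' := by
    intro a x hx c
    have h1 := hx c
    simp only [Pi.smul_apply, smul_eq_mul]
    linear_combination a * h1

/-- How often a cycle runs through the band at the crossing `c`, from left to right. -/
def bandFlow (D : LinkDiagram) (x : D.cycles) (c : Fin D.n) : ℤ :=
  x.1 (D.outArc c .right) - x.1 (D.inArc c .right)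

/-- The cycles that are constant along every Seifert circle, i.e. the linear combinations of Seifert
circles. These are the cycles that bound in `F`. -/
def seifertCircles (D : LinkDiagram) : Submodule ℤ D.cycles where
  carrier := {x | ∀ c s, x.1 (D.inArc c s) = x.1 (D.outArc c s)}
  add_mem' := by
    intro x y hx hy c s
    simp [hx c s, hy c s]
  zero_mem' := by intro c s; simp
  smul_mem' := by
    intro a x hx c s
    simp [hx c s]

/-- The first homology group of `F`. -/
abbrev SurfaceHomology (D : LinkDiagram) : Type := D.cycles ⧸ D.seifertCircles

/-- The linking number of `x` with the push-off of `y` in the positive normal direction of `F`.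
Close to the Seifert circles, `F` is a wall above them, and the positive normal points to the right
of each circle. So the push-off of `y` passes under `x` only where `y` passes through a band,
namely below the right strand of the smoothed crossing, each time with sign `-1`; it meets the part
of `x` that leaves the crossing there, or, by the opposite twist of the band, the part that arrives
there. -/
def linking (D : LinkDiagram) (x y : D.cycles) : ℤ :=
  -∑ c, D.bandFlow y c *
    (if D.positive c = true then x.1 (D.outArc c .right) else x.1 (D.inArc c .right))

/-- The number of pieces of the diagram, which is the number of connected components of `F`. -/
noncomputable def pieces (D : LinkDiagram) : ℕ := D.graphPieces + D.circles

end LinkDiagram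

/-- The enlargement with block rows `(A, ξ, 0)`, `(0, 0, 1)`, `(0, 0, 0)`, where `ξ` is a column. -/
def Matrix.seifertEnlarge {g : ℕ} (A : Matrix (Fin g) (Fin g) ℤ) (ξ : Fin g → ℤ) :
    Matrix (Fin (g + 2)) (Fin (g + 2)) ℤ :=
  Matrix.reindex finSumFinEquiv finSumFinEquiv
    (Matrix.fromBlocks A (Matrix.of fun i => ![ξ i, 0]) 0 !![0, 1; 0, 0])

/-- The Seifert matrices of the link presented by `D`. First, there are those of the surface `F`, for
any basis of its first homology. A Seifert surface is connected: if `F` is not, its components are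
joined by `pieces - 1` tubes, whose meridians are further basis elements
with linking number zero with everything. Next, all matrices are added that result
from these by S-equivalence, that is, by changes of basis and by enlargements and reductions. This
accounts for all Seifert surfaces of the link. -/
inductive LinkDiagram.IsSeifertMatrix (D : LinkDiagram) :
    ∀ {g : ℕ}, Matrix (Fin g) (Fin g) ℤ → Prop
  | surface {g : ℕ} (b : Module.Basis (Fin g) ℤ D.SurfaceHomology) (γ : Fin g → D.cycles)
      (hγ : ∀ i, D.seifertCircles.mkQ (γ i) = b i) :
      IsSeifertMatrix D (Matrix.reindex finSumFinEquiv finSumFinEquiv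
        (Matrix.fromBlocks (Matrix.of fun i j => D.linking (γ i) (γ j)) 0 0
          (0 : Matrix (Fin (D.pieces - 1)) (Fin (D.pieces - 1)) ℤ)))
  | baseChange {g : ℕ} (A P : Matrix (Fin g) (Fin g) ℤ) (hP : IsUnit P.det)
      (hA : IsSeifertMatrix D A) : IsSeifertMatrix D (P * A * P.transpose)
  | enlarge {g : ℕ} (A : Matrix (Fin g) (Fin g) ℤ) (ξ : Fin g → ℤ)
      (hA : IsSeifertMatrix D A) : IsSeifertMatrix D (A.seifertEnlarge ξ)
  | reduce {g : ℕ} (A : Matrix (Fin g) (Fin g) ℤ) (ξ : Fin g → ℤ)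
      (hA : IsSeifertMatrix D (A.seifertEnlarge ξ)) : IsSeifertMatrix D A
  | enlargeTranspose {g : ℕ} (A : Matrix (Fin g) (Fin g) ℤ) (ξ : Fin g → ℤ)
      (hA : IsSeifertMatrix D A) :
      IsSeifertMatrix D (A.transpose.seifertEnlarge ξ).transpose
  | reduceTranspose {g : ℕ} (A : Matrix (Fin g) (Fin g) ℤ) (ξ : Fin g → ℤ)
      (hA : IsSeifertMatrix D (A.transpose.seifertEnlarge ξ).transpose) :
      IsSeifertMatrix D A

/-- Every diagram has a Seifert matrix. -/
theorem LinkDiagram.exists_isSeifertMatrix (D : LinkDiagram) :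
    ∃ (g : ℕ) (A : Matrix (Fin g) (Fin g) ℤ), D.IsSeifertMatrix A := by
  have tf : Module.IsTorsionFree ℤ D.SurfaceHomology := by
    refine .of_smul_eq_zero fun a v hv => ?_
    obtain ⟨x, rfl⟩ := D.seifertCircles.mkQ_surjective v
    rw [← map_smul, Submodule.mkQ_apply, Submodule.Quotient.mk_eq_zero] at hv
    rw [Submodule.mkQ_apply, Submodule.Quotient.mk_eq_zero]
    by_cases ha : a = 0
    · exact .inl ha
    · refine .inr fun c s => ?_
      have h := hv c s
      simpa [ha] using h
  have b := Module.finBasis ℤ D.SurfaceHomology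
  choose γ hγ using fun i => D.seifertCircles.mkQ_surjective (b i)
  exact ⟨_, _, .surface b γ hγ⟩

/-- The symmetrized Seifert matrix. -/
def symmetrized {g : ℕ} (A : Matrix (Fin g) (Fin g) ℤ) : Matrix (Fin g) (Fin g) ℤ :=
  A + A.transpose

/-- The signature of a symmetric integer matrix: the number of its positive eigenvalues minus the
number of its negative ones, with multiplicity. -/
noncomputable def matrixSignature {g : ℕ} (M : Matrix (Fin g) (Fin g) ℤ) : ℤ :=
  let eigenvalues : Multiset ℝ := (M.map (fun a : ℤ => (a : ℝ))).charpoly.roots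
  (eigenvalues.countP (fun r => 0 < r) : ℤ) - (eigenvalues.countP (fun r => r < 0) : ℤ)

open LaurentPolynomial in
/-- The Alexander polynomial in the Conway normalization, `det (- q A + q⁻¹ Aᵀ)` with
`q = t ^ (1 / 2)`, computed from a Seifert matrix `A`. -/
noncomputable def alexander {g : ℕ} (A : Matrix (Fin g) (Fin g) ℤ) : LaurentPolynomial ℤ :=
  (-(T 1 : LaurentPolynomial ℤ) • A.map (fun a => (C a : LaurentPolynomial ℤ)) +
    (T (-1) : LaurentPolynomial ℤ) • A.transpose.map (fun a => C a)).det

/-- The value at `t = -1` of a Laurent polynomial in `t ^ (1 / 2)`: as `-1 = exp (π i)`, it is the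
value at `t ^ (1 / 2) = exp (π i / 2) = i`. -/
noncomputable def evalNegOne (p : LaurentPolynomial ℤ) : ℂ :=
  LaurentPolynomial.eval₂ (Int.castRingHom ℂ) (Units.mk0 Complex.I Complex.I_ne_zero) p

/-!
At `t = -1` the loop value of the Kauffman state sum is zero, so `V (-1)` is a sum of powers of `I`
over the states with a single circle. The theorem says that this sum is the determinant of the
symmetrized Seifert form `M`, up to a power of `I` that depends on the number of rows only:
`V (-1) = I ^ g * det M`. The rest is linear algebra. The Alexander polynomial has the value
`(-I) ^ g * det M`, the spectral theorem turns `I ^ g` and the sign of `det M` into `I ^ σ`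
(`I_pow_mul_det`), and `g` has the parity of `c - 1` (`LinkDiagram.neg_one_pow_components`). Both
`I ^ g * det M` and `(-I) ^ g * det M` are invariant under S-equivalence
(`LinkDiagram.IsSeifertMatrix.phase_eq`), so that only the surface of the diagram has to be
considered, and if the diagram is not connected, both `V (-1)` and `det M` vanish.

For a connected diagram, let `S_c x` be the upward flow of a cycle `x` at the crossing `c`, and
`F_c x` its flow through the band at `c`. Planarity means that every cycle is a boundary of regions
(`LinkShadow.range_faceBoundary`, by a dimension count), hence that the intersection number of two
cycles is zero. Therefore `M (x, y) = ∑ c, F_c y * (S_c x - ε_c * F_c x)`, where `ε_c` is the sign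
of the crossing (`LinkDiagram.linking_add_linking`). Planarity also gives a checkerboard coloring of
the regions. If the arcs are oriented with black on the left, every state becomes a permutation `π`
of the arcs whose cycles are the circles of the state, and a cofactor of `1 - π` is `1` or `0`
according to whether there is a single circle (`Equiv.Perm.det_laplacian`). In these coordinates the
equations `F_c x = 0` and `S_c x = 0` are what the two smoothings of `c` require of a flow. By
multilinearity in the rows, the determinant of the system that consists of the conservation of flow
and of the forms `S_c + t_c * F_c` (up to a sign for each crossing) is the sum of `∏ t_c`, over the
states with a single circle, the product being taken over the crossings that are smoothed along the
orientation (`LinkShadow.Checkerboard.det_flowMatrix`).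

This determinant is compared with `det M` by means of one state whose changed crossings form a
spanning tree of the Seifert graph: it is unimodular, and its dual basis contains a basis of the
homology of the Seifert surface (`LinkDiagram.det_linking_add_linking`). Finally, the phases of the
terms of the two sums agree because the states with a single circle correspond to spanning trees of
the graph of black regions, which all have the same number of edges
(`LinkShadow.Checkerboard.sum_sgn_eq`).
-/

/-! ### Quotients of finite types by generated equivalence relations -/

theorem card_quot_le_of_imp {α : Type*} [Finite α] {r r' : α → α → Prop}
    (h : ∀ a b, r a b → Quot.mk r' a = Quot.mk r' b) :
    Nat.card (Quot r') ≤ Nat.card (Quot r) := by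
  refine Nat.card_le_card_of_surjective (Quot.lift (Quot.mk r') h) ?_
  rintro ⟨a⟩
  exact ⟨Quot.mk r a, rfl⟩

theorem card_quot_congr {α : Type*} [Finite α] {r r' : α → α → Prop}
    (h : ∀ a b, r a b → Quot.mk r' a = Quot.mk r' b)
    (h' : ∀ a b, r' a b → Quot.mk r a = Quot.mk r b) :
    Nat.card (Quot r) = Nat.card (Quot r') :=
  le_antisymm (card_quot_le_of_imp h') (card_quot_le_of_imp h)

/-- Identifying one more pair of points lowers the number of classes by at most one. -/
theorem card_quot_le_add_one {α : Type*} [Finite α] {r r' : α → α → Prop} (x y : α)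
    (h : ∀ a b, r' a b → r a b ∨ (a = x ∧ b = y)) :
    Nat.card (Quot r) ≤ Nat.card (Quot r') + 1 := by
  classical
  let φ : α → Quot r := fun a => if Quot.mk r a = Quot.mk r x then Quot.mk r y else Quot.mk r a
  have hφ : ∀ a b, r' a b → φ a = φ b := by
    intro a b hab
    rcases h a b hab with hr | ⟨rfl, rfl⟩
    · simp only [φ, Quot.sound hr]
    · simp only [φ, if_true]
      split_ifs <;> rfl
  rw [← Finite.card_option]
  refine Nat.card_le_card_of_surjective
    (fun q : Option (Quot r') => q.elim (Quot.mk r x) (Quot.lift φ hφ)) ?_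
  rintro ⟨a⟩
  by_cases ha : Quot.mk r a = Quot.mk r x
  · exact ⟨none, ha.symm⟩
  · exact ⟨some (Quot.mk r' a), by simp [φ, ha]⟩

theorem card_quot_lt_of_imp {α : Type*} [Finite α] {r r' : α → α → Prop}
    (h : ∀ a b, r a b → Quot.mk r' a = Quot.mk r' b) {x y : α}
    (hne : Quot.mk r x ≠ Quot.mk r y) (heq : Quot.mk r' x = Quot.mk r' y) :
    Nat.card (Quot r') < Nat.card (Quot r) := by
  have hle := card_quot_le_of_imp h
  refine lt_of_le_of_ne hle fun hcard => hne ?_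
  have hs : Function.Surjective (Quot.lift (Quot.mk r') h) := by
    rintro ⟨a⟩
    exact ⟨Quot.mk r a, rfl⟩
  have hb : Function.Bijective (Quot.lift (Quot.mk r') h) :=
    (Nat.bijective_iff_surjective_and_card _).2 ⟨hs, hcard.symm⟩
  exact hb.1 heq

/-! ### The number of cycles of a permutation -/

namespace Equiv.Perm

/-- The number of orbits of a permutation, that is, of its cycles, fixed points included. -/
noncomputable def orbitCount {α : Type*} (σ : Equiv.Perm α) : ℕ :=
  Nat.card (Quot fun a b => σ a = b)

theorem quot_mk_apply {α : Type*} (σ : Equiv.Perm α) (a : α) :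
    Quot.mk (fun a b => σ a = b) (σ a) = Quot.mk (fun a b => σ a = b) a :=
  (Quot.sound (r := fun a b => σ a = b) rfl).symm

theorem quot_eq_iff_sameCycle {α : Type*} (σ : Equiv.Perm α) (a b : α) :
    Quot.mk (fun a b => σ a = b) a = Quot.mk (fun a b => σ a = b) b ↔ σ.SameCycle a b := by
  constructor
  · intro h
    have := Quot.eqvGen_exact h
    clear h
    induction this with
    | rel a b hab => exact ⟨1, by simpa using hab⟩
    | refl a => exact SameCycle.refl _ _
    | symm a b _ ih => exact ih.symm
    | trans a b c _ _ ih1 ih2 => exact ih1.trans ih2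
  · have key : ∀ (n : ℕ) (a : α), Quot.mk (fun a b => σ a = b) ((σ ^ n) a) =
        Quot.mk (fun a b => σ a = b) a := by
      intro n
      induction n with
      | zero => intro a; rfl
      | succ n ih =>
        intro a
        rw [pow_succ', Perm.mul_apply, ← ih a]
        exact quot_mk_apply _ _
    rintro ⟨i, rfl⟩
    obtain ⟨n, rfl | rfl⟩ := i.eq_nat_or_neg
    · rw [zpow_natCast, key]
    · rw [← key n ((σ ^ (-(n : ℤ))) a), zpow_neg, zpow_natCast]
      simp

theorem orbitCount_eq {α : Type*} [Fintype α] [DecidableEq α] (σ : Equiv.Perm α) :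
    σ.orbitCount = σ.cycleType.card + (Fintype.card α - σ.support.card) := by
  classical
  let f : α → σ.cycleFactorsFinset ⊕ {a // σ a = a} := fun a =>
    if h : σ a = a then .inr ⟨a, h⟩
    else .inl ⟨σ.cycleOf a, cycleOf_mem_cycleFactorsFinset_iff.2 (mem_support.2 h)⟩
  have hf : ∀ a b, σ a = b → f a = f b := by
    rintro a _ rfl
    by_cases h : σ a = a
    · simp [h]
    · have h' : σ (σ a) ≠ σ a := fun h' => h (σ.injective h')
      have hc : σ.cycleOf (σ a) = σ.cycleOf a :=
        SameCycle.cycleOf_eq (SameCycle.symm ⟨1, by simp⟩)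
      simp only [f, h, h', dif_neg, not_false_eq_true, hc]
  have hbij : Function.Bijective (Quot.lift f hf) := by
    constructor
    · rintro ⟨a⟩ ⟨b⟩ hab
      change f a = f b at hab
      refine (quot_eq_iff_sameCycle σ a b).2 ?_
      by_cases ha : σ a = a <;> by_cases hb : σ b = b
      · simp only [f, ha, hb, dif_pos, Sum.inr.injEq, Subtype.mk.injEq] at hab
        subst hab
        exact SameCycle.refl _ _
      · simp [f, ha, hb] at hab
      · simp [f, ha, hb] at hab
      · simp only [f, ha, hb, dif_neg, not_false_eq_true, Sum.inl.injEq, Subtype.mk.injEq] at hab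
        exact (sameCycle_iff_cycleOf_eq_of_mem_support (mem_support.2 ha) (mem_support.2 hb)).2 hab
    · rintro (⟨τ, hτ⟩ | ⟨a, ha⟩)
      · obtain ⟨a, ha⟩ := (mem_cycleFactorsFinset_iff.1 hτ).1
        have hτa := (cycle_is_cycleOf (mem_support.2 ha.1) hτ).symm
        have hσ : σ a ≠ a := by
          rw [← (mem_cycleFactorsFinset_iff.1 hτ).2 a (mem_support.2 ha.1)]
          exact ha.1
        exact ⟨Quot.mk _ a, by simp [f, hσ, hτa]⟩
      · exact ⟨Quot.mk _ a, by simp [f, ha]⟩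
  rw [orbitCount, Nat.card_congr (Equiv.ofBijective _ hbij), Nat.card_sum]
  congr 1
  · simp [cycleType]
  · rw [Nat.card_eq_fintype_card, ← Finset.card_compl, Fintype.card_subtype]
    congr 1
    ext a
    simp

/-- The sign of a permutation determines the parity of the number of its orbits. -/
theorem neg_one_pow_orbitCount {α : Type*} [Fintype α] [DecidableEq α] (σ : Equiv.Perm α) :
    (-1 : ℤ) ^ σ.orbitCount = sign σ * (-1) ^ Fintype.card α := by
  have hle : σ.support.card ≤ Fintype.card α := Finset.card_le_univ _
  have hsum := σ.sum_cycleType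
  rw [orbitCount_eq, sign_of_cycleType, hsum]
  push_cast
  have : Fintype.card α = (Fintype.card α - σ.support.card) + σ.support.card := by omega
  conv_rhs => rw [this]
  rw [pow_add, pow_add, pow_add]
  have h1 : (-1 : ℤ) ^ σ.support.card * (-1) ^ σ.support.card = 1 := by
    rw [← mul_pow]; norm_num
  linear_combination (-((-1 : ℤ) ^ σ.cycleType.card *
    (-1) ^ (Fintype.card α - σ.support.card))) * h1

theorem sameCycle_of_orbitCount_eq_one {α : Type*} (σ : Equiv.Perm α)
    (h : σ.orbitCount = 1) (a b : α) : σ.SameCycle a b := by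
  have := (Nat.card_eq_one_iff_unique.1 h).1
  exact (quot_eq_iff_sameCycle σ a b).1 (Subsingleton.elim _ _)

/-- The matrix `1 - P` of a permutation, with an additional unit entry at the place `(a, a)`. -/
def laplacian {α : Type*} [DecidableEq α] (σ : Equiv.Perm α) (a : α) : Matrix α α ℤ :=
  Matrix.of fun i => Pi.single i 1 - Pi.single (σ i) 1 + if i = a then Pi.single a 1 else 0

theorem laplacian_mulVec {α : Type*} [Fintype α] [DecidableEq α] (σ : Equiv.Perm α) (a : α)
    (v : α → ℤ) (i : α) :
    (σ.laplacian a).mulVec v i = v i - v (σ i) + if i = a then v a else 0 := by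
  change (Pi.single i 1 - Pi.single (σ i) 1 + if i = a then Pi.single a 1 else 0) ⬝ᵥ v = _
  rw [add_dotProduct, sub_dotProduct, single_one_dotProduct, single_one_dotProduct]
  split_ifs <;> simp

/-- A cofactor of `1 - P` is one for a full cycle and zero for every other permutation. -/
theorem det_laplacian {α : Type*} [Fintype α] [DecidableEq α] (σ : Equiv.Perm α) (a : α) :
    (σ.laplacian a).det = if σ.orbitCount = 1 then 1 else 0 := by
  classical
  have entry : ∀ i j, σ.laplacian a i j = (if j = i then 1 else 0) - (if j = σ i then 1 else 0) +
      (if i = a ∧ j = a then 1 else 0) := by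
    intro i j
    by_cases hi : i = a <;> simp [laplacian, Pi.single_apply, hi]
  split_ifs with h
  · have hsame := σ.sameCycle_of_orbitCount_eq_one h
    by_cases hfix : σ a = a
    · -- A full cycle with a fixed point lives on a single point.
      have hsub : ∀ b, b = a := fun b => by
        obtain ⟨i, hi⟩ := hsame a b
        rw [← hi, zpow_apply_eq_self_of_apply_eq_self hfix]
      have : Unique α := ⟨⟨a⟩, hsub⟩
      rw [Matrix.det_unique, entry]
      simp [hfix, hsub default]
    have hmove : ∀ i, σ i ≠ i := fun i hi => by
      obtain ⟨m, hm⟩ := hsame i a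
      rw [zpow_apply_eq_self_of_apply_eq_self hi] at hm
      exact hfix (hm ▸ hi)
    have hne1 : (1 : Perm α) ≠ σ := fun h1 => hfix (by rw [← h1]; rfl)
    have hzero : ∀ τ : Perm α, τ ≠ 1 → τ ≠ σ → ∏ i, σ.laplacian a i (τ i) = 0 := by
      intro τ h1 h2
      by_contra hprod
      have hnz : ∀ i, τ i = i ∨ τ i = σ i := by
        intro i
        by_contra hi
        push Not at hi
        refine hprod (Finset.prod_eq_zero (Finset.mem_univ i) ?_)
        rw [entry]
        have : ¬ (i = a ∧ τ i = a) := fun ⟨x, y⟩ => hi.1 (y.trans x.symm)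
        simp [hi.1, hi.2, this]
      -- The points at which `τ` agrees with `σ` are closed under `σ`.
      have hstep : ∀ i, τ i = σ i → τ (σ i) = σ (σ i) := by
        intro i hi
        rcases hnz (σ i) with h | h
        · exact absurd (τ.injective (h.trans hi.symm)) (hmove i)
        · exact h
      obtain ⟨i, hi⟩ : ∃ i, τ i = σ i := by
        by_contra hno
        push Not at hno
        exact h1 (ext fun i => (hnz i).resolve_right (hno i))
      refine h2 (ext fun j => ?_)
      obtain ⟨m, hm⟩ := (hsame i j).exists_nat_pow_eq
      have : ∀ m : ℕ, τ ((σ ^ m) i) = σ ((σ ^ m) i) := by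
        intro m
        induction m with
        | zero => exact hi
        | succ m ih => rw [pow_succ', mul_apply]; exact hstep _ ih
      rw [← hm]
      exact this m
    rw [← Matrix.det_transpose, Matrix.det_apply,
      ← Finset.sum_subset (Finset.subset_univ {1, σ})]
    · rw [Finset.sum_pair hne1]
      have hcyc : σ.IsCycle := ⟨a, hfix, fun b _ => hsame a b⟩
      have hsupp : σ.support = Finset.univ := by ext i; simp [hmove i]
      have e1 : ∏ i, (σ.laplacian a).transpose ((1 : Perm α) i) i = 2 := by
        rw [Finset.prod_eq_single a]
        · simp [entry, Ne.symm hfix]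
        · intro b _ hb
          simp [entry, (hmove b).symm, hb]
        · simp
      have e2 : ∏ i, (σ.laplacian a).transpose (σ i) i = (-1) ^ Fintype.card α := by
        rw [Finset.prod_congr rfl (g := fun _ => (-1 : ℤ))]
        · simp
        · intro b _
          have : ¬ (b = a ∧ σ b = a) := fun ⟨x, y⟩ => hmove b (y.trans x.symm)
          simp [entry, hmove b, this]
      rw [e1, e2, hcyc.sign, hsupp, Finset.card_univ]
      have : (-1 : ℤ) ^ Fintype.card α * (-1) ^ Fintype.card α = 1 := by
        rw [← mul_pow]; norm_num
      simp [Units.smul_def, this]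
    · intro τ _ hτ
      simp only [Finset.mem_insert, Finset.mem_singleton, not_or] at hτ
      have : ∏ i, (σ.laplacian a).transpose (τ i) i = 0 := hzero τ hτ.1 hτ.2
      rw [this, smul_zero]
  · -- The indicator of the points outside of the orbit of `a` lies in the kernel.
    rw [← Matrix.exists_mulVec_eq_zero_iff]
    let q : α → Quot fun a b => σ a = b := Quot.mk _
    have hq : ∀ i, q (σ i) = q i := fun i => σ.quot_mk_apply i
    refine ⟨fun i => if q i = q a then 0 else 1, fun h0 => h ?_, ?_⟩
    · refine Nat.card_eq_one_iff_unique.2 ⟨⟨?_⟩, ⟨q a⟩⟩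
      have : ∀ i, q i = q a := fun i => by simpa using congrFun h0 i
      rintro ⟨i⟩ ⟨j⟩
      exact (this i).trans (this j).symm
    · ext i
      rw [laplacian_mulVec, hq]
      by_cases hi : i = a <;> simp [hi]

end Equiv.Perm

/-! ### Smoothings of a shadow -/

namespace Side

/-- The opposite side. -/
def other : Side → Side
  | left => right
  | right => left

@[simp] theorem other_left : left.other = right := rfl
@[simp] theorem other_right : right.other = left := rfl
@[simp] theorem other_other (s : Side) : s.other.other = s := by cases s <;> rfl

theorem univ_eq : (Finset.univ : Finset Side) = {left, right} := rfl

theorem sum_eq {M : Type*} [AddCommMonoid M] (f : Side → M) : ∑ s, f s = f left + f right := by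
  rw [univ_eq, Finset.sum_pair (by decide)]

theorem card_eq : Fintype.card Side = 2 := rfl

end Side

namespace LinkShadow

variable (S : LinkShadow)

/-- Smoothing of the crossings of a shadow: along the orientation where `o` is `true`, and against
it where `o` is `false`. -/
inductive Smoothed (o : Fin S.n → Bool) : S.Arc → S.Arc → Prop
  | oriented (c : Fin S.n) (side : Side) (h : o c = true) :
      Smoothed o (S.inArc c side) (S.outArc c side)
  | lower (c : Fin S.n) (h : o c = false) :
      Smoothed o (S.inArc c .left) (S.inArc c .right)
  | upper (c : Fin S.n) (h : o c = false) :
      Smoothed o (S.outArc c .left) (S.outArc c .right)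

/-- The number of circles of a smoothing. -/
noncomputable def circuits (o : Fin S.n → Bool) : ℕ := Nat.card (Quot (S.Smoothed o))

variable {S}

theorem inArc_next (a : S.Arc) : S.inArc (S.next a).1 (S.next a).2 = a := by simp [inArc]

@[simp] theorem next_inArc (c : Fin S.n) (s : Side) : S.next (S.inArc c s) = (c, s) := by
  simp [inArc]

variable (S) in
/-- The relation that is generated by both smoothings of the crossing `c` together. -/
def Joined (o : Fin S.n → Bool) (c : Fin S.n) (x y : S.Arc) : Prop :=
  S.Smoothed o x y ∨ S.Smoothed (Function.update o c !o c) x y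

theorem joined_update (o : Fin S.n → Bool) (c : Fin S.n) :
    S.Joined (Function.update o c !o c) c = S.Joined o c := by
  funext x y
  simp [Joined, or_comm]

theorem circuits_le_joined (o : Fin S.n → Bool) (c : Fin S.n) :
    S.circuits o ≤ Nat.card (Quot (S.Joined o c)) + 1 := by
  have hother : ∀ {c' x}, c' ≠ c → Function.update o c (!o c) c' = x → o c' = x := by
    intro c' x hc h
    rwa [Function.update_of_ne hc] at h
  -- Joining the two circles that meet at `c` identifies all four ends there.
  cases hoc : o c
  · let r : S.Arc → S.Arc → Prop := fun x y =>
      S.Smoothed o x y ∨ (x = S.inArc c .left ∧ y = S.outArc c .left)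
    refine (card_quot_le_add_one (r := S.Smoothed o) (r' := r) _ _ fun _ _ h => h).trans ?_
    have hl : Quot.mk r (S.inArc c .left) = Quot.mk r (S.outArc c .left) :=
      Quot.sound (.inr ⟨rfl, rfl⟩)
    have hr : Quot.mk r (S.inArc c .right) = Quot.mk r (S.outArc c .right) :=
      (Quot.sound (r := r) (.inl (.lower c hoc))).symm.trans
        (hl.trans (Quot.sound (.inl (.upper c hoc))))
    refine Nat.succ_le_succ (card_quot_le_of_imp ?_)
    rintro x y (h | ⟨c', side, h⟩ | ⟨c', h⟩ | ⟨c', h⟩)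
    · exact Quot.sound (.inl h)
    · by_cases hc : c' = c
      · subst hc
        cases side
        exacts [hl, hr]
      · exact Quot.sound (.inl (.oriented c' side (hother hc h)))
    · by_cases hc : c' = c
      · subst hc
        exact Quot.sound (.inl (.lower c' hoc))
      · exact Quot.sound (.inl (.lower c' (hother hc h)))
    · by_cases hc : c' = c
      · subst hc
        exact Quot.sound (.inl (.upper c' hoc))
      · exact Quot.sound (.inl (.upper c' (hother hc h)))
  · let r : S.Arc → S.Arc → Prop := fun x y =>
      S.Smoothed o x y ∨ (x = S.inArc c .left ∧ y = S.inArc c .right)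
    refine (card_quot_le_add_one (r := S.Smoothed o) (r' := r) _ _ fun _ _ h => h).trans ?_
    have hl : Quot.mk r (S.inArc c .left) = Quot.mk r (S.inArc c .right) :=
      Quot.sound (.inr ⟨rfl, rfl⟩)
    have hr : Quot.mk r (S.outArc c .left) = Quot.mk r (S.outArc c .right) :=
      (Quot.sound (r := r) (.inl (.oriented c .left hoc))).symm.trans
        (hl.trans (Quot.sound (.inl (.oriented c .right hoc))))
    refine Nat.succ_le_succ (card_quot_le_of_imp ?_)
    rintro x y (h | ⟨c', side, h⟩ | ⟨c', h⟩ | ⟨c', h⟩)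
    · exact Quot.sound (.inl h)
    · by_cases hc : c' = c
      · subst hc
        exact Quot.sound (.inl (.oriented c' side hoc))
      · exact Quot.sound (.inl (.oriented c' side (hother hc h)))
    · by_cases hc : c' = c
      · subst hc
        exact hl
      · exact Quot.sound (.inl (.lower c' (hother hc h)))
    · by_cases hc : c' = c
      · subst hc
        exact hr
      · exact Quot.sound (.inl (.upper c' (hother hc h)))

theorem joined_le_circuits (o : Fin S.n → Bool) (c : Fin S.n) :
    Nat.card (Quot (S.Joined o c)) ≤ S.circuits o :=
  card_quot_le_of_imp fun _ _ h => Quot.sound (.inl h)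

/-- Changing the smoothing of a single crossing changes the number of circles by at most one. -/
theorem circuits_le_update (o : Fin S.n → Bool) (c : Fin S.n) (b : Bool) :
    S.circuits o ≤ S.circuits (Function.update o c b) + 1 := by
  by_cases hb : b = o c
  · rw [hb, Function.update_eq_self]; omega
  · have : b = !o c := by cases b <;> cases h : o c <;> simp_all
    subst this
    have h1 := circuits_le_joined o c
    have h2 := joined_le_circuits (Function.update o c !o c) c
    rw [joined_update] at h2
    omega

/-- The numbers of circles of two smoothings differ by at most the number of the crossings at which
the smoothings differ. -/
theorem circuits_le_add_card (o o' : Fin S.n → Bool) :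
    S.circuits o ≤ S.circuits o' + (Finset.univ.filter fun c => o c ≠ o' c).card := by
  induction hm : (Finset.univ.filter fun c => o c ≠ o' c).card generalizing o with
  | zero =>
    have : o = o' := by
      funext c
      by_contra hc
      rw [Finset.card_eq_zero] at hm
      have : c ∈ (∅ : Finset (Fin S.n)) := hm ▸ Finset.mem_filter.2 ⟨Finset.mem_univ _, hc⟩
      simp at this
    rw [this]; omega
  | succ m ih =>
    obtain ⟨c, hc⟩ := Finset.card_pos.1
      (by omega : 0 < (Finset.univ.filter fun c => o c ≠ o' c).card)
    have hset : (Finset.univ.filter fun x => Function.update o c (o' c) x ≠ o' x) =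
        (Finset.univ.filter fun c => o c ≠ o' c).erase c := by
      ext x
      by_cases hx : x = c
      · subst hx; simp
      · simp [hx]
    have := ih (Function.update o c (o' c)) (by rw [hset, Finset.card_erase_of_mem hc, hm]; rfl)
    have h2 := circuits_le_update o c (o' c)
    omega

/-! ### Checkerboard colorings -/

variable (S) in
/-- A checkerboard coloring of the regions of a shadow. It is encoded by the arcs `a` that have a
black region on their left: `k a = true`. The color is constant along Seifert circles, and differs
for the two strands of a smoothed crossing. -/
structure Checkerboard where
  k : S.Arc → Bool
  next_eq : ∀ a, k (S.next a) = k a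
  right_eq : ∀ c, k (c, .right) = !k (c, .left)

namespace Checkerboard

variable (χ : S.Checkerboard)

theorem inArc_eq (c : Fin S.n) (s : Side) : χ.k (S.inArc c s) = χ.k (c, s) := by
  rw [← χ.next_eq, next_inArc]

/-- Orient the black arcs forward and the others backward. This sends each strand of an oriented
smoothing to the end at which it enters the crossing. -/
def enter : Equiv.Perm (Fin S.n × Side) where
  toFun p := if χ.k p then S.next.symm p else p
  invFun p := if χ.k p then S.next p else p
  left_inv p := by
    have : χ.k (S.next.symm p) = χ.k p := by rw [← χ.next_eq, Equiv.apply_symm_apply]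
    by_cases h : χ.k p <;> simp [h, this]
  right_inv p := by
    by_cases h : χ.k p <;> simp [h, χ.next_eq]

/-- The end at which a strand of an oriented smoothing leaves the crossing, when the black arcs are
oriented forward and the others backward. -/
def leave : Equiv.Perm (Fin S.n × Side) where
  toFun p := if χ.k p then p else S.next.symm p
  invFun p := if χ.k p then p else S.next p
  left_inv p := by
    have : χ.k (S.next.symm p) = χ.k p := by rw [← χ.next_eq, Equiv.apply_symm_apply]
    by_cases h : χ.k p <;> simp [h, this]
  right_inv p := by
    by_cases h : χ.k p <;> simp [h, χ.next_eq]

theorem enter_apply (c : Fin S.n) (s : Side) :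
    χ.enter (c, s) = if χ.k (c, s) then S.inArc c s else S.outArc c s := rfl

theorem leave_apply (c : Fin S.n) (s : Side) :
    χ.leave (c, s) = if χ.k (c, s) then S.outArc c s else S.inArc c s := rfl

/-- The passage from an entrance to the next entrance in the oriented smoothing. -/
def advance : Equiv.Perm (Fin S.n × Side) := χ.leave.trans χ.enter.symm

theorem enter_advance (p : Fin S.n × Side) : χ.enter (χ.advance p) = χ.leave p := by
  simp [advance]

end Checkerboard

variable (S) in
/-- The exchange of the two strands at the crossings that are not smoothed along the
orientation. -/
def exchange (o : Fin S.n → Bool) : Equiv.Perm (Fin S.n × Side) :=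
  Equiv.prodCongrRight fun c => if o c then 1 else Equiv.swap .left .right

theorem exchange_apply (o : Fin S.n → Bool) (c : Fin S.n) (s : Side) :
    S.exchange o (c, s) = (c, if o c then s else s.other) := by
  cases h : o c <;> cases s <;> simp [exchange, h]

theorem sign_exchange (o : Fin S.n → Bool) :
    (Equiv.Perm.sign (S.exchange o) : ℤ) =
      (-1) ^ (Finset.univ.filter fun c => o c = false).card := by
  have : ∀ c, Equiv.Perm.sign (if o c = true then 1 else Equiv.swap Side.left Side.right) =
      if o c = false then -1 else 1 := by
    intro c
    cases o c <;> simp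
  rw [exchange, Equiv.Perm.sign_prodCongrRight, Finset.prod_congr rfl fun c _ => this c,
    Finset.prod_ite]
  simp

namespace Checkerboard

variable (χ : S.Checkerboard)

/-- The passage from an entrance to the next entrance in the smoothing `o`. -/
def walk (o : Fin S.n → Bool) : Equiv.Perm (Fin S.n × Side) :=
  (S.exchange o).trans χ.advance

theorem walk_apply (o : Fin S.n → Bool) (c : Fin S.n) (s : Side) :
    χ.walk o (c, s) = χ.advance (c, if o c then s else s.other) := by
  simp [walk, exchange_apply]

/-- The circles of a smoothing are the orbits of the walk along it. -/
theorem circuits_eq_orbitCount (o : Fin S.n → Bool) : S.circuits o = (χ.walk o).orbitCount := by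
  rw [Equiv.Perm.orbitCount, circuits]
  symm
  refine (Nat.card_congr (Quot.congr (rb := fun a b => ∃ p, a = χ.enter p ∧
    b = χ.enter (χ.walk o p)) χ.enter ?_)).trans (card_quot_congr ?_ ?_)
  · intro p q
    constructor
    · rintro rfl; exact ⟨p, rfl, rfl⟩
    · rintro ⟨r, h1, h2⟩
      rw [χ.enter.injective h1, χ.enter.injective h2]
  · rintro _ _ ⟨⟨c, s⟩, rfl, rfl⟩
    rw [walk_apply, enter_advance, enter_apply, leave_apply]
    cases ho : o c
    · have hl := Quot.sound (Smoothed.lower (S := S) (o := o) c ho)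
      have hu := Quot.sound (Smoothed.upper (S := S) (o := o) c ho)
      cases s <;> cases hk : χ.k (c, .left) <;>
        simp [χ.right_eq, hk, hl, hu]
    · have hs := fun s => Quot.sound (Smoothed.oriented (S := S) (o := o) c s ho)
      cases hk : χ.k (c, s) <;> simp [hk, hs]
  · have key : ∀ c s, Quot.mk (fun a b => ∃ p, a = χ.enter p ∧ b = χ.enter (χ.walk o p))
        (χ.enter (c, s)) = Quot.mk _ (χ.leave (c, if o c then s else s.other)) := by
      intro c s
      refine Quot.sound ⟨(c, s), rfl, ?_⟩
      rw [walk_apply, enter_advance]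
    rintro _ _ (⟨c, s, h⟩ | ⟨c, h⟩ | ⟨c, h⟩)
    · have := key c s
      cases hk : χ.k (c, s) <;> simp [enter_apply, leave_apply, h, hk] at this
      · exact this.symm
      · exact this
    · have h1 := key c .left
      have h2 := key c .right
      cases hk : χ.k (c, .left) <;>
        simp [enter_apply, leave_apply, h, hk, χ.right_eq] at h1 h2
      · exact h2.symm
      · exact h1
    · have h1 := key c .left
      have h2 := key c .right
      cases hk : χ.k (c, .left) <;>
        simp [enter_apply, leave_apply, h, hk, χ.right_eq] at h1 h2
      · exact h1
      · exact h2.symm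

theorem neg_one_pow_circuits (o : Fin S.n → Bool) :
    (-1 : ℤ) ^ S.circuits o = Equiv.Perm.sign χ.advance *
      (-1) ^ (Finset.univ.filter fun c => o c = false).card := by
  rw [χ.circuits_eq_orbitCount, Equiv.Perm.neg_one_pow_orbitCount, Fintype.card_prod,
    Side.card_eq, mul_comm (Fintype.card _) 2, pow_mul, walk, Equiv.Perm.sign_trans]
  push_cast
  rw [sign_exchange]
  norm_num

/-- In the plane, a change of the smoothing of one crossing changes the number of circles. -/
theorem circuits_update_ne (χ : S.Checkerboard) (o : Fin S.n → Bool) (c : Fin S.n) :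
    S.circuits (Function.update o c (!o c)) ≠ S.circuits o := by
  intro h
  have h1 := χ.neg_one_pow_circuits o
  have h2 := χ.neg_one_pow_circuits (Function.update o c (!o c))
  have hs : (-1 : ℤ) ^ (Finset.univ.filter fun x => Function.update o c (!o c) x = false).card =
      - (-1) ^ (Finset.univ.filter fun x => o x = false).card := by
    cases hoc : o c
    · have : (Finset.univ.filter fun x => o x = false) =
          insert c (Finset.univ.filter fun x => Function.update o c (!false) x = false) := by
        ext x
        by_cases hx : x = c
        · subst hx; simp [hoc]
        · simp [hx]
      rw [this, Finset.card_insert_of_notMem (by simp), pow_succ]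
      ring
    · have : (Finset.univ.filter fun x => Function.update o c (!true) x = false) =
          insert c (Finset.univ.filter fun x => o x = false) := by
        ext x
        by_cases hx : x = c
        · subst hx; simp [hoc]
        · simp [hx]
      rw [this, Finset.card_insert_of_notMem (by simp [hoc]), pow_succ]
      ring
  rw [hs, h, h1] at h2
  have hne : (Equiv.Perm.sign χ.advance : ℤ) *
      (-1) ^ (Finset.univ.filter fun x => o x = false).card ≠ 0 :=
    mul_ne_zero (Units.ne_zero _) (by simp)
  apply hne
  linarith

/-- As long as there are several circles, some crossing meets two of them, if the graph is
connected. Changing the smoothing there joins these two. -/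
theorem exists_circuits_update_lt (χ : S.Checkerboard) (hS : S.graphPieces = 1)
    (o : Fin S.n → Bool) (ho : 1 < S.circuits o) :
    ∃ c, S.circuits (Function.update o c !o c) < S.circuits o := by
  by_contra! hno
  have hall : ∀ c x y, S.Joined o c x y → Quot.mk (S.Smoothed o) x = Quot.mk (S.Smoothed o) y := by
    intro c x y hxy
    by_contra hne
    have h1 : Nat.card (Quot (S.Joined o c)) < S.circuits o :=
      card_quot_lt_of_imp (fun _ _ h => Quot.sound (.inl h)) hne (Quot.sound hxy)
    have h2 := circuits_le_joined (Function.update o c !o c) c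
    rw [joined_update] at h2
    exact χ.circuits_update_ne o c (le_antisymm (by omega) (hno c))
  have hside : ∀ c s, Quot.mk (S.Smoothed o) (S.inArc c s) =
      Quot.mk (S.Smoothed o) (S.outArc c s) := by
    intro c s
    cases hoc : o c
    · exact hall c _ _ (.inr (.oriented c s (by simp [hoc])))
    · exact hall c _ _ (.inl (.oriented c s hoc))
  have hlow : ∀ c, Quot.mk (S.Smoothed o) (S.inArc c .left) =
      Quot.mk (S.Smoothed o) (S.inArc c .right) := by
    intro c
    cases hoc : o c
    · exact hall c _ _ (.inl (.lower c hoc))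
    · exact hall c _ _ (.inr (.lower c (by simp [hoc])))
  have : S.circuits o ≤ S.graphPieces := by
    refine card_quot_le_of_imp ?_
    rintro _ _ (⟨c, s, s'⟩ | ⟨c⟩)
    · have h1 := hside c .left
      have h2 := hside c .right
      have h3 := hlow c
      cases s <;> cases s' <;> simp_all
    · exact hlow c
  omega

/-- Starting with the Seifert circles, one can join circles until a single one is left. -/
theorem exists_circuits_eq_one (χ : S.Checkerboard) (hS : S.graphPieces = 1) (hn : 0 < S.n) :
    ∃ o : Fin S.n → Bool, S.circuits o = 1 ∧
      S.circuits (fun _ => true) = 1 + (Finset.univ.filter fun c => o c = false).card := by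
  have hpos : ∀ o : Fin S.n → Bool, 0 < S.circuits o := fun o => by
    have : Nonempty (Quot (S.Smoothed o)) := ⟨Quot.mk _ (⟨0, hn⟩, .left)⟩
    exact Finite.card_pos
  suffices ∀ m, ∀ o : Fin S.n → Bool, S.circuits o = m + 1 →
      S.circuits (fun _ => true) = m + 1 + (Finset.univ.filter fun c => o c = false).card →
      ∃ o : Fin S.n → Bool, S.circuits o = 1 ∧
        S.circuits (fun _ => true) = 1 + (Finset.univ.filter fun c => o c = false).card by
    have h0 := hpos fun _ => true
    exact this (S.circuits (fun _ => true) - 1) (fun _ => true) (by omega) (by simp; omega)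
  intro m
  induction m with
  | zero => intro o h1 h2; exact ⟨o, h1, by omega⟩
  | succ m ih =>
    intro o h1 h2
    obtain ⟨c, hc⟩ := χ.exists_circuits_update_lt hS o (by omega)
    have hle := circuits_le_update o c !o c
    have hall := circuits_le_add_card (fun _ => true) (Function.update o c !o c)
    cases hoc : o c
    · -- Undoing a change cannot join two circles, as this would leave too few changes in total.
      exfalso
      have : (Finset.univ.filter fun x => o x = false) =
          insert c (Finset.univ.filter fun x => true ≠ Function.update o c (!o c) x) := by
        ext x
        by_cases hx : x = c
        · subst hx; simp [hoc]
        · cases h : o x <;> simp [hx, h]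
      rw [this, Finset.card_insert_of_notMem (by simp [hoc])] at h2
      omega
    · refine ih (Function.update o c !o c) (by omega) ?_
      have : (Finset.univ.filter fun x => Function.update o c (!o c) x = false) =
          insert c (Finset.univ.filter fun x => o x = false) := by
        ext x
        by_cases hx : x = c
        · subst hx; simp [hoc]
        · simp [hx]
      rw [this, Finset.card_insert_of_notMem (by simp [hoc])]
      omega

end Checkerboard

end LinkShadow

namespace LinkShadow

variable {S : LinkShadow}

/-! ### Cycles on a plane graph are boundaries -/

section Homology

variable (S) (K : Type*) [Field K]

/-- The boundary of a 2-chain, with coefficients in `K`. -/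
def faceBoundary : (Quot S.Corner → K) →ₗ[K] (S.Arc → K) where
  toFun u a := u (Quot.mk _ (a, .left)) - u (Quot.mk _ (a, .right))
  map_add' u v := by ext a; simp; ring
  map_smul' t u := by ext a; simp; ring

/-- The boundary of a 1-chain, with coefficients in `K`. -/
def arcBoundary : (S.Arc → K) →ₗ[K] (Fin S.n → K) where
  toFun x c := x (S.inArc c .left) + x (S.inArc c .right) -
    (x (S.outArc c .left) + x (S.outArc c .right))
  map_add' x y := by ext c; simp; ring
  map_smul' t x := by ext c; simp; ring

variable {S K}

theorem faceBoundary_apply (u : Quot S.Corner → K) (a : S.Arc) :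
    S.faceBoundary K u a = u (Quot.mk _ (a, .left)) - u (Quot.mk _ (a, .right)) := rfl

theorem mem_ker_arcBoundary {x : S.Arc → K} : x ∈ LinearMap.ker (S.arcBoundary K) ↔
    ∀ c, x (S.inArc c .left) + x (S.inArc c .right) =
      x (S.outArc c .left) + x (S.outArc c .right) := by
  rw [LinearMap.mem_ker, funext_iff]
  exact forall_congr' fun c => sub_eq_zero

theorem arcBoundary_single (a : S.Arc) :
    S.arcBoundary K (Pi.single a 1) = Pi.single (S.next a).1 1 - Pi.single a.1 1 := by
  classical
  ext c
  have hin : ∀ s, S.inArc c s = a ↔ S.next a = (c, s) := fun s =>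
    S.next.symm_apply_eq.trans eq_comm
  obtain ⟨c', s'⟩ := a
  obtain ⟨⟨d, t⟩, h⟩ : ∃ p, S.next (c', s') = p := ⟨_, rfl⟩
  simp only [arcBoundary, LinearMap.coe_mk, AddHom.coe_mk, Pi.single_apply, hin, h, outArc,
    Pi.sub_apply, Prod.mk.injEq]
  by_cases h1 : d = c <;> by_cases h2 : c = c' <;> cases s' <;> cases t <;>
    simp [h1, h2, eq_comm (b := d)]

theorem finrank_ker_faceBoundary_le (hS : S.graphPieces = 1) (hn : 0 < S.n) :
    Module.finrank K (LinearMap.ker (S.faceBoundary K)) ≤ 1 := by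
  have hsub := (Nat.card_eq_one_iff_unique.1 hS).1
  have key : ∀ u ∈ LinearMap.ker (S.faceBoundary K), ∀ F G, u F = u G := by
    intro u hu
    have hlr : ∀ a, u (Quot.mk _ (a, .left)) = u (Quot.mk _ (a, .right)) := fun a =>
      sub_eq_zero.1 (congrFun (LinearMap.mem_ker.1 hu) a)
    have hmeet : ∀ a b, S.Meet a b →
        u (Quot.mk _ (a, .left)) = u (Quot.mk _ (b, .left)) := by
      have low : ∀ c, u (Quot.mk _ (S.inArc c .left, .left)) =
          u (Quot.mk _ (S.inArc c .right, .left)) := fun c => by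
        rw [hlr (S.inArc c .left), ← Quot.sound (Corner.lower c)]
      have lft : ∀ c, u (Quot.mk _ (S.inArc c .left, .left)) =
          u (Quot.mk _ (S.outArc c .left, .left)) := fun c => by
        rw [Quot.sound (Corner.left c)]
      have rgt : ∀ c, u (Quot.mk _ (S.inArc c .right, .left)) =
          u (Quot.mk _ (S.outArc c .right, .left)) := fun c => by
        rw [hlr, hlr, Quot.sound (Corner.right c)]
      rintro _ _ (⟨c, s, s'⟩ | ⟨c⟩)
      · have h1 := low c
        have h2 := lft c
        have h3 := rgt c
        cases s <;> cases s' <;> simp_all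
      · exact low c
    have hconst : ∀ a b : S.Arc, u (Quot.mk _ (a, .left)) = u (Quot.mk _ (b, .left)) := by
      intro a b
      exact congrArg (Quot.lift (fun a => u (Quot.mk _ (a, .left))) hmeet)
        (Subsingleton.elim (Quot.mk _ a) (Quot.mk _ b))
    rintro ⟨⟨a, s⟩⟩ ⟨⟨b, t⟩⟩
    cases s <;> cases t
    · exact hconst a b
    · exact (hconst a b).trans (hlr b)
    · exact (hlr a).symm.trans (hconst a b)
    · exact (hlr a).symm.trans ((hconst a b).trans (hlr b))
  let F₀ : Quot S.Corner := Quot.mk _ ((⟨0, hn⟩, .left), .left)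
  have h1 : (fun _ => 1 : Quot S.Corner → K) ∈ LinearMap.ker (S.faceBoundary K) := by
    rw [LinearMap.mem_ker]
    ext a
    simp [faceBoundary_apply]
  refine finrank_le_one ⟨fun _ => 1, h1⟩ fun u => ⟨u.1 F₀, Subtype.ext (funext fun F => ?_)⟩
  simpa using key u.1 u.2 F₀ F

theorem finrank_ker_arcBoundary_le (hS : S.graphPieces = 1) :
    Module.finrank K (LinearMap.ker (S.arcBoundary K)) ≤ S.n + 1 := by
  have hsub := (Nat.card_eq_one_iff_unique.1 hS).1
  let Q := (Fin S.n → K) ⧸ LinearMap.range (S.arcBoundary K)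
  let f : S.Arc → Q := fun a => Submodule.Quotient.mk (Pi.single a.1 1)
  have hf : ∀ a, Submodule.Quotient.mk (p := LinearMap.range (S.arcBoundary K))
      (Pi.single (S.next a).1 1) = f a := fun a =>
    (Submodule.Quotient.eq _).2 ⟨_, arcBoundary_single a⟩
  have hmeet : ∀ a b, S.Meet a b → f a = f b := by
    have hin : ∀ c s, f (S.inArc c s) = Submodule.Quotient.mk (Pi.single c 1) := fun c s => by
      rw [← hf, next_inArc]
    rintro _ _ (⟨c, s, s'⟩ | ⟨c⟩)
    · rw [hin]; rfl
    · rw [hin, hin]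
  have hconst : ∀ a b : S.Arc, f a = f b := fun a b =>
    congrArg (Quot.lift f hmeet) (Subsingleton.elim (Quot.mk _ a) (Quot.mk _ b))
  have hQ : Module.finrank K Q ≤ 1 := by
    obtain ⟨⟨a⟩⟩ := (Nat.card_eq_one_iff_unique.1 hS).2
    refine finrank_le_one (f a) fun w => ?_
    obtain ⟨w, rfl⟩ := Submodule.Quotient.mk_surjective _ w
    refine ⟨∑ c, w c, ?_⟩
    have hw : w = ∑ c, w c • (Pi.single c 1 : Fin S.n → K) := by
      ext c
      simp [Finset.sum_apply, Pi.single_apply]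
    conv_rhs => rw [hw]
    rw [← Submodule.mkQ_apply, map_sum, Finset.sum_smul]
    refine Finset.sum_congr rfl fun c _ => ?_
    rw [map_smul, Submodule.mkQ_apply, hconst a (c, .left)]
  have h1 := Submodule.finrank_quotient_add_finrank (LinearMap.range (S.arcBoundary K))
  have h2 := (S.arcBoundary K).finrank_range_add_finrank_ker
  rw [Module.finrank_fintype_fun_eq_card] at h1 h2
  rw [Fintype.card_prod, Side.card_eq] at h2
  rw [Fintype.card_fin] at h1 h2
  change Module.finrank K Q + _ = _ at h1
  omega

/-- The first homology group of a connected plane graph is generated by the boundaries of the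
faces. This is where planarity enters. -/
theorem range_faceBoundary (hS : S.graphPieces = 1) (hn : 0 < S.n) (hp : S.IsPlanar) :
    LinearMap.range (S.faceBoundary K) = LinearMap.ker (S.arcBoundary K) := by
  classical
  refine Submodule.eq_of_le_of_finrank_le ?_ ?_
  · rintro _ ⟨u, rfl⟩
    rw [mem_ker_arcBoundary]
    intro c
    have h1 := congrArg u (Quot.sound (Corner.upper (S := S) c))
    have h2 := congrArg u (Quot.sound (Corner.right (S := S) c))
    have h3 := congrArg u (Quot.sound (Corner.lower (S := S) c))
    have h4 := congrArg u (Quot.sound (Corner.left (S := S) c))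
    simp only [faceBoundary_apply]
    rw [h2, h3, h4, h1]
    ring
  · have h1 := (S.faceBoundary K).finrank_range_add_finrank_ker
    have h2 := finrank_ker_faceBoundary_le (K := K) hS hn
    have h3 := finrank_ker_arcBoundary_le (K := K) hS
    have : Fintype (Quot S.Corner) := Fintype.ofFinite _
    rw [Module.finrank_fintype_fun_eq_card, ← Nat.card_eq_fintype_card] at h1
    have h4 : Nat.card (Quot S.Corner) = S.n + 2 * S.graphPieces := hp
    omega

/-- Two cycles in the plane have intersection number zero. -/
theorem intersection_eq_zero (hS : S.graphPieces = 1) (hn : 0 < S.n) (hp : S.IsPlanar)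
    {x y : S.Arc → K} (hx : x ∈ LinearMap.ker (S.arcBoundary K))
    (hy : y ∈ LinearMap.ker (S.arcBoundary K)) :
    ∑ c, ((x (S.inArc c .left) + x (S.inArc c .right)) *
        (y (S.outArc c .right) - y (S.inArc c .right)) -
      (y (S.inArc c .left) + y (S.inArc c .right)) *
        (x (S.outArc c .right) - x (S.inArc c .right))) = 0 := by
  rw [← range_faceBoundary hS hn hp] at hx
  obtain ⟨u, rfl⟩ := hx
  rw [mem_ker_arcBoundary] at hy
  let w : S.Arc → K := fun a => y a * (u (Quot.mk _ (a, .left)) + u (Quot.mk _ (a, .right)))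
  -- Each arc contributes to the crossing where it starts and to the one where it ends.
  have hw : ∑ p : Fin S.n × Side, w p = ∑ p, w (S.next.symm p) :=
    (Equiv.sum_comp S.next.symm w).symm
  rw [Fintype.sum_prod_type, Fintype.sum_prod_type, ← sub_eq_zero, ← Finset.sum_sub_distrib] at hw
  rw [← neg_eq_zero, ← hw, ← Finset.sum_neg_distrib]
  refine Finset.sum_congr rfl fun c _ => ?_
  have h1 := congrArg u (Quot.sound (Corner.upper (S := S) c))
  have h2 := congrArg u (Quot.sound (Corner.right (S := S) c))
  have h3 := congrArg u (Quot.sound (Corner.lower (S := S) c))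
  have h4 := congrArg u (Quot.sound (Corner.left (S := S) c))
  have h5 := hy c
  rw [Side.sum_eq, Side.sum_eq]
  change _ = w (S.outArc c .left) + w (S.outArc c .right) -
    (w (S.inArc c .left) + w (S.inArc c .right))
  simp only [faceBoundary_apply, w]
  rw [h2, h3, h4, h1]
  linear_combination (u (Quot.mk _ (S.outArc c .left, .left)) +
    u (Quot.mk _ (S.outArc c .left, .right))) * h5

end Homology

/-! ### The regions of a checkerboard coloring -/

/-- The regions of a connected plane graph have a checkerboard coloring, because the sum of all arcs
is a cycle modulo 2, hence the boundary of a set of regions. -/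
theorem exists_checkerboard (hS : S.graphPieces = 1) (hn : 0 < S.n) (hp : S.IsPlanar) :
    Nonempty S.Checkerboard := by
  have h1 : (fun _ => 1 : S.Arc → ZMod 2) ∈ LinearMap.ker (S.arcBoundary (ZMod 2)) :=
    mem_ker_arcBoundary.2 fun c => rfl
  rw [← range_faceBoundary hS hn hp] at h1
  obtain ⟨u, hu⟩ := h1
  have hlr : ∀ a, u (Quot.mk _ (a, .left)) = u (Quot.mk _ (a, .right)) + 1 := fun a => by
    rw [← sub_eq_iff_eq_add']
    exact congrFun hu a
  have hin : ∀ c s, u (Quot.mk _ (S.outArc c s, .left)) = u (Quot.mk _ (S.inArc c s, .left)) := by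
    intro c s
    cases s
    · rw [Quot.sound (Corner.left c)]
    · rw [hlr, hlr, Quot.sound (Corner.right c)]
  refine ⟨⟨fun a => decide (u (Quot.mk _ (a, .left)) = 1), fun a => ?_, fun c => ?_⟩⟩
  · have := hin (S.next a).1 (S.next a).2
    rw [inArc_next] at this
    simp only [decide_eq_decide]
    rw [← this]
    rfl
  · have h1 := congrArg u (Quot.sound (Corner.upper (S := S) c))
    have h2 := hlr (S.outArc c .left)
    change decide (u (Quot.mk _ (S.outArc c .right, .left)) = 1) =
      !decide (u (Quot.mk _ (S.outArc c .left, .left)) = 1)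
    rw [h1, h2]
    generalize u (Quot.mk _ (S.outArc c .left, .right)) = z
    revert z
    decide

namespace Checkerboard

variable (χ : S.Checkerboard)

/-- The smoothing whose circles bound the black regions. -/
def blackState (c : Fin S.n) : Bool := χ.k (c, .left)

/-- The smoothing whose circles bound the white regions. -/
def whiteState (c : Fin S.n) : Bool := !χ.k (c, .left)

/-- The side of an arc on which the region of the color `b` lies. -/
def sideOf (b : Bool) (a : S.Arc) : Side := if χ.k a = b then .left else .right

theorem quot_mk_sideOf_eq (b : Bool) {o : Fin S.n → Bool}
    (ho : ∀ c, o c = (χ.k (c, .left) == b)) (x y : S.Arc) (h : S.Smoothed o x y) :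
    Quot.mk S.Corner (x, χ.sideOf b x) = Quot.mk S.Corner (y, χ.sideOf b y) := by
  rcases h with ⟨c, s, h⟩ | ⟨c, h⟩ | ⟨c, h⟩
  all_goals rw [ho] at h
  · cases s
    · have := Quot.sound (Corner.left (S := S) c)
      simp_all [sideOf, inArc_eq, outArc]
    · have := Quot.sound (Corner.right (S := S) c)
      cases b <;> simp_all [sideOf, inArc_eq, outArc, χ.right_eq]
  · have := Quot.sound (Corner.lower (S := S) c)
    cases b <;> simp_all [sideOf, inArc_eq, χ.right_eq]
  · have := Quot.sound (Corner.upper (S := S) c)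
    cases b <;> simp_all [sideOf, outArc, χ.right_eq]

/-- Every region is black or white, and thus bounded by a circle of the black or of the white
state. -/
theorem circuits_add_circuits : S.circuits χ.blackState + S.circuits χ.whiteState = S.faces := by
  let f : S.Arc × Side → Quot (S.Smoothed χ.blackState) ⊕ Quot (S.Smoothed χ.whiteState) :=
    fun p => if χ.sideOf true p.1 = p.2 then .inl (Quot.mk _ p.1) else .inr (Quot.mk _ p.1)
  have hf : ∀ p q, S.Corner p q → f p = f q := by
    rintro _ _ (⟨c⟩ | ⟨c⟩ | ⟨c⟩ | ⟨c⟩)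
    all_goals
      have hr := χ.right_eq c
      have hl' := χ.inArc_eq c .left
      have hr' := χ.inArc_eq c .right
      have b1 := fun h => Quot.sound (Smoothed.oriented (S := S) (o := χ.blackState) c .left h)
      have b2 := fun h => Quot.sound (Smoothed.oriented (S := S) (o := χ.blackState) c .right h)
      have b3 := fun h => Quot.sound (Smoothed.lower (S := S) (o := χ.blackState) c h)
      have b4 := fun h => Quot.sound (Smoothed.upper (S := S) (o := χ.blackState) c h)
      have w1 := fun h => Quot.sound (Smoothed.oriented (S := S) (o := χ.whiteState) c .left h)
      have w2 := fun h => Quot.sound (Smoothed.oriented (S := S) (o := χ.whiteState) c .right h)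
      have w3 := fun h => Quot.sound (Smoothed.lower (S := S) (o := χ.whiteState) c h)
      have w4 := fun h => Quot.sound (Smoothed.upper (S := S) (o := χ.whiteState) c h)
      cases hk : χ.k (c, .left) <;>
        simp_all [f, sideOf, outArc, blackState, whiteState]
  let g : Quot (S.Smoothed χ.blackState) ⊕ Quot (S.Smoothed χ.whiteState) → Quot S.Corner :=
    Sum.elim
      (Quot.lift (fun a => Quot.mk _ (a, χ.sideOf true a))
        (χ.quot_mk_sideOf_eq true fun c => by simp [blackState]))
      (Quot.lift (fun a => Quot.mk _ (a, χ.sideOf false a))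
        (χ.quot_mk_sideOf_eq false fun c => by simp [whiteState]))
  have e : Quot S.Corner ≃ Quot (S.Smoothed χ.blackState) ⊕ Quot (S.Smoothed χ.whiteState) :=
    { toFun := Quot.lift f hf
      invFun := g
      left_inv := by
        rintro ⟨a, s⟩
        cases hk : χ.k a <;> cases s <;> simp [f, g, sideOf, hk]
      right_inv := by
        rintro (q | q) <;> obtain ⟨a⟩ := q
        · simp [f, g]
        · cases hk : χ.k a <;> simp [f, g, sideOf, hk] }
  rw [faces, Nat.card_congr e, Nat.card_sum]
  rfl

/-- The sign of a crossing with respect to the coloring: `1` if the regions on the left and on the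
right of the crossing are black, and `-1` if they are white. -/
def sgn (c : Fin S.n) : ℤ := if χ.k (c, .left) then 1 else -1

theorem sgn_mul_self (c : Fin S.n) : χ.sgn c * χ.sgn c = 1 := by
  unfold sgn; split_ifs <;> rfl

/-- The states with a single circle correspond to the spanning trees of the graph of black
regions. As all these trees have the same number of edges, the signs of the crossings that are
smoothed along the orientation have the same sum in each of these states. -/
theorem sum_sgn_eq (hS : S.graphPieces = 1) (hp : S.IsPlanar) (o : Fin S.n → Bool)
    (ho : S.circuits o = 1) :
    ∑ c with o c = true, χ.sgn c = S.circuits χ.whiteState - 1 -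
      ∑ c, (if χ.k (c, .left) then 0 else 1) := by
  -- By Euler's formula, both of these inequalities are equalities.
  have h1 := circuits_le_add_card χ.blackState o
  have h2 := circuits_le_add_card χ.whiteState o
  have h3 := χ.circuits_add_circuits
  have h4 : S.faces = S.n + 2 * S.graphPieces := hp
  have h5 : (Finset.univ.filter fun c => χ.blackState c ≠ o c).card +
      (Finset.univ.filter fun c => χ.whiteState c ≠ o c).card = S.n := by
    have : (Finset.univ.filter fun c => χ.whiteState c ≠ o c) =
        Finset.univ.filter fun c => ¬ χ.blackState c ≠ o c := by
      refine Finset.filter_congr fun c _ => ?_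
      cases h : χ.k (c, .left) <;> cases h' : o c <;> simp [blackState, whiteState, h]
    rw [this, Finset.card_filter_add_card_filter_not, Finset.card_univ, Fintype.card_fin]
  have h6 : ((Finset.univ.filter fun c => χ.whiteState c ≠ o c).card : ℤ) =
      ∑ c with o c = true, χ.sgn c + ∑ c, (if χ.k (c, .left) then 0 else 1) := by
    rw [Finset.card_filter, Finset.sum_filter, ← Finset.sum_add_distrib]
    push_cast
    refine Finset.sum_congr rfl fun c _ => ?_
    cases h : χ.k (c, .left) <;> cases h' : o c <;> simp [sgn, whiteState, h]
  omega

end Checkerboard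

end LinkShadow

namespace LinkShadow

variable {S : LinkShadow}

/-! ### Cycles in the coordinates of a checkerboard coloring -/

section Gauge

variable {R : Type*} [CommRing R]

/-- The flow upward through a crossing. -/
def upFlow (x : S.Arc → R) (c : Fin S.n) : R := x (S.inArc c .left) + x (S.inArc c .right)

/-- The flow through the band at a crossing, from right to left. -/
def leftFlow (x : S.Arc → R) (c : Fin S.n) : R := x (S.inArc c .right) - x (S.outArc c .right)

namespace Checkerboard

variable (χ : S.Checkerboard)

/-- The sign of an arc: `1` if the region on its left is black, and `-1` if it is white. -/
def arcSgn (p : Fin S.n × Side) : ℤ := if χ.k p then 1 else -1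

theorem arcSgn_mul_self (p : Fin S.n × Side) : (χ.arcSgn p : R) * χ.arcSgn p = 1 := by
  unfold arcSgn; split_ifs <;> simp

theorem arcSgn_right (c : Fin S.n) : χ.arcSgn (c, .right) = -χ.sgn c := by
  cases h : χ.k (c, .left) <;> simp [arcSgn, sgn, χ.right_eq, h]

theorem k_enter (p : Fin S.n × Side) : χ.k (χ.enter p) = χ.k p := by
  obtain ⟨c, s⟩ := p
  rw [enter_apply]
  split_ifs
  · exact χ.inArc_eq c s
  · rfl

theorem k_leave (p : Fin S.n × Side) : χ.k (χ.leave p) = χ.k p := by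
  obtain ⟨c, s⟩ := p
  rw [leave_apply]
  split_ifs
  · rfl
  · exact χ.inArc_eq c s

/-- The coefficient of a chain at an entrance of a crossing, with respect to the orientation of the
arcs that is given by the checkerboard coloring. -/
def gauge (x : S.Arc → R) (p : Fin S.n × Side) : R := χ.arcSgn p * x (χ.enter p)

theorem gauge_advance (x : S.Arc → R) (p : Fin S.n × Side) :
    χ.gauge x (χ.advance p) = χ.arcSgn p * x (χ.leave p) := by
  have : χ.k (χ.advance p) = χ.k p := by rw [← k_enter, enter_advance, k_leave]
  rw [gauge, enter_advance, arcSgn, this, arcSgn]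

theorem gauge_sub_gauge_advance (x : S.Arc → R) (c : Fin S.n) (s : Side) :
    χ.gauge x (c, s) - χ.gauge x (χ.advance (c, s)) = x (S.inArc c s) - x (S.outArc c s) := by
  rw [gauge_advance, gauge, enter_apply, leave_apply, arcSgn]
  cases χ.k (c, s) <;> simp
  ring

theorem gauge_right_sub_gauge_advance_left {x : S.Arc → R} {c : Fin S.n}
    (hx : x (S.inArc c .left) + x (S.inArc c .right) =
      x (S.outArc c .left) + x (S.outArc c .right)) :
    χ.gauge x (c, .right) - χ.gauge x (χ.advance (c, .left)) =
      χ.arcSgn (c, .right) * S.upFlow x c := by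
  rw [gauge_advance, gauge, enter_apply, leave_apply, arcSgn, arcSgn, χ.right_eq]
  cases χ.k (c, .left)
  · simp [upFlow]; ring
  · simp [upFlow]; linear_combination hx

end Checkerboard

end Gauge

/-! ### The state sum as a determinant -/

namespace Checkerboard

variable (χ : S.Checkerboard)

/-- The row that belongs to the conservation of flow at the crossing `c`. -/
def conservationRow (c₀ c : Fin S.n) : Fin S.n × Side → ℤ :=
  (Pi.single (c, .left) 1 - Pi.single (χ.advance (c, .left)) 1) +
    (Pi.single (c, .right) 1 - Pi.single (χ.advance (c, .right)) 1) +
    if c = c₀ then Pi.single (c₀, .left) 1 else 0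

/-- The row of a crossing that is smoothed along the orientation. -/
def orientedRow (c : Fin S.n) : Fin S.n × Side → ℤ :=
  Pi.single (c, .right) 1 - Pi.single (χ.advance (c, .right)) 1

/-- The row of a crossing that is smoothed against the orientation. -/
def unorientedRow (c : Fin S.n) : Fin S.n × Side → ℤ :=
  Pi.single (c, .right) 1 - Pi.single (χ.advance (c, .left)) 1

/-- The matrix with two rows for each crossing: the conservation of flow, and a given row. The
conservation laws add up to zero, which is remedied by an additional entry at `(c₀, .left)`. -/
def flowMatrix (c₀ : Fin S.n) (w : Fin S.n → Fin S.n × Side → ℤ) :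
    Matrix (Fin S.n × Side) (Fin S.n × Side) ℤ :=
  Matrix.of fun p => match p.2 with
    | .left => χ.conservationRow c₀ p.1
    | .right => w p.1

theorem flowMatrix_update (c₀ : Fin S.n) (w : Fin S.n → Fin S.n × Side → ℤ) (c : Fin S.n)
    (v : Fin S.n × Side → ℤ) :
    χ.flowMatrix c₀ (Function.update w c v) =
      (χ.flowMatrix c₀ w).updateRow (c, .right) v := by
  ext ⟨c', s⟩ j
  by_cases hc : c' = c
  · subst hc
    cases s <;> simp [flowMatrix, Matrix.updateRow_apply]
  · cases s <;> simp [flowMatrix, Matrix.updateRow_apply, hc]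

/-- The determinant of `flowMatrix`, as a multilinear function of the variable rows. -/
def flowDet (c₀ : Fin S.n) : MultilinearMap ℤ (fun _ : Fin S.n => Fin S.n × Side → ℤ) ℤ where
  toFun w := (χ.flowMatrix c₀ w).det
  map_update_add' {inst} w c x y := by
    obtain rfl : inst = instDecidableEqFin S.n := Subsingleton.elim _ _
    simp only [flowMatrix_update]
    rw [Matrix.det_updateRow_add]
  map_update_smul' {inst} w c t x := by
    obtain rfl : inst = instDecidableEqFin S.n := Subsingleton.elim _ _
    simp only [flowMatrix_update]
    rw [Matrix.det_updateRow_smul, smul_eq_mul]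

/-- The rows that belong to a state. -/
def stateRow (o : Fin S.n → Bool) (c : Fin S.n) : Fin S.n × Side → ℤ :=
  if o c then χ.orientedRow c else χ.unorientedRow c

/-- The determinant of a state tells whether it has a single circle. -/
theorem det_flowMatrix_stateRow (c₀ : Fin S.n) (o : Fin S.n → Bool) :
    (χ.flowMatrix c₀ (χ.stateRow o)).det = if S.circuits o = 1 then 1 else 0 := by
  -- Row operations lead to the matrix of the walk along the smoothing.
  let B : Matrix (Fin S.n × Side) (Fin S.n × Side) ℤ := Matrix.of fun p =>
    Pi.single p 1 + if p.2 = .left then Pi.single (p.1, .right) 1 else 0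
  have hB : B.det = 1 := by
    rw [Matrix.twoBlockTriangular_det B (fun p => p.2 = .left)]
    · have h1 : B.toSquareBlockProp (fun p => p.2 = .left) = 1 := by
        ext ⟨⟨c, s⟩, hs⟩ ⟨⟨c', s'⟩, hs'⟩
        dsimp only at hs hs'
        subst hs hs'
        simp [B, Matrix.toSquareBlockProp, Matrix.toBlock, Matrix.one_apply, Pi.single_apply,
          eq_comm]
      have h2 : B.toSquareBlockProp (fun p => ¬ p.2 = .left) = 1 := by
        ext ⟨⟨c, s⟩, hs⟩ ⟨⟨c', s'⟩, hs'⟩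
        dsimp only at hs hs'
        simp [B, Matrix.toSquareBlockProp, Matrix.toBlock, Matrix.one_apply, Pi.single_apply,
          eq_comm, hs]
      rw [h1, h2, Matrix.det_one, Matrix.det_one, mul_one]
    · rintro ⟨c, s⟩ hs ⟨c', s'⟩ hs'
      dsimp only at hs hs'
      subst hs'
      have : (c', Side.left) ≠ (c, s) := fun h => hs (congrArg Prod.snd h).symm
      simp [B, hs, this]
  have hmul : χ.flowMatrix c₀ (χ.stateRow o) = B * (χ.walk o).laplacian (c₀, .left) := by
    ext ⟨c, s⟩ j
    rw [Matrix.mul_apply']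
    change _ = (Pi.single (c, s) 1 + if s = .left then Pi.single (c, .right) 1 else 0 :
      Fin S.n × Side → ℤ) ⬝ᵥ _
    cases s
    · have hl := χ.walk_apply o c .left
      have hr := χ.walk_apply o c .right
      by_cases hc : c = c₀
      · subst hc
        cases h : o c <;>
          simp [add_dotProduct, flowMatrix, conservationRow, Equiv.Perm.laplacian, hl, hr, h] <;>
          ring
      · cases h : o c
        all_goals
          simp [add_dotProduct, flowMatrix, conservationRow, Equiv.Perm.laplacian, hl, hr, h, hc]
          try ring
    · cases h : o c <;>
        simp [flowMatrix, stateRow, orientedRow, unorientedRow, Equiv.Perm.laplacian,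
          walk_apply, h]
  rw [hmul, Matrix.det_mul, hB, one_mul, Equiv.Perm.det_laplacian, circuits_eq_orbitCount]

/-- The determinantal form of the state sum. -/
theorem det_flowMatrix (c₀ : Fin S.n) (t : Fin S.n → ℤ) :
    (χ.flowMatrix c₀ fun c => t c • χ.orientedRow c + χ.unorientedRow c).det =
      ∑ o : Fin S.n → Bool with S.circuits o = 1, ∏ c with o c = true, t c := by
  have h := (χ.flowDet c₀).map_sum (α := fun _ => Bool)
    (fun c b => (if b then t c else 1) • (if b then χ.orientedRow c else χ.unorientedRow c))
  have hs : (fun c => ∑ b : Bool, (if b then t c else 1) •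
      (if b then χ.orientedRow c else χ.unorientedRow c)) =
      fun c => t c • χ.orientedRow c + χ.unorientedRow c := by
    funext c
    simp
  rw [hs] at h
  rw [Finset.sum_filter]
  refine h.trans (Finset.sum_congr rfl fun o _ => ?_)
  change χ.flowDet c₀ (fun c => (if o c then t c else 1) • χ.stateRow o c) = _
  rw [MultilinearMap.map_smul_univ (χ.flowDet c₀) (fun c => if o c then t c else 1)
    (χ.stateRow o), Finset.prod_ite, Finset.prod_const_one, mul_one]
  change _ • (χ.flowMatrix c₀ (χ.stateRow o)).det = _
  rw [det_flowMatrix_stateRow]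
  simp

/-- The rows of `flowMatrix` on the coordinates of a cycle. -/
theorem flowMatrix_mulVec_right (c₀ : Fin S.n) (w : Fin S.n → Fin S.n × Side → ℤ)
    (v : Fin S.n × Side → ℤ) (c : Fin S.n) :
    (χ.flowMatrix c₀ w).mulVec v (c, .right) = w c ⬝ᵥ v := rfl

theorem flowMatrix_mulVec_left (c₀ : Fin S.n) (w : Fin S.n → Fin S.n × Side → ℤ)
    (v : Fin S.n × Side → ℤ) (c : Fin S.n) :
    (χ.flowMatrix c₀ w).mulVec v (c, .left) = (v (c, .left) - v (χ.advance (c, .left))) +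
      (v (c, .right) - v (χ.advance (c, .right))) + if c = c₀ then v (c₀, .left) else 0 := by
  change χ.conservationRow c₀ c ⬝ᵥ v = _
  rw [conservationRow, add_dotProduct, add_dotProduct, sub_dotProduct, sub_dotProduct]
  split_ifs <;> simp

theorem orientedRow_dotProduct (x : S.Arc → ℤ) (c : Fin S.n) :
    χ.orientedRow c ⬝ᵥ χ.gauge x = S.leftFlow x c := by
  rw [orientedRow, sub_dotProduct, single_one_dotProduct, single_one_dotProduct,
    gauge_sub_gauge_advance, leftFlow]

theorem unorientedRow_dotProduct {x : S.Arc → ℤ} {c : Fin S.n}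
    (hx : x (S.inArc c .left) + x (S.inArc c .right) =
      x (S.outArc c .left) + x (S.outArc c .right)) :
    χ.unorientedRow c ⬝ᵥ χ.gauge x = χ.arcSgn (c, .right) * S.upFlow x c := by
  rw [unorientedRow, sub_dotProduct, single_one_dotProduct, single_one_dotProduct,
    gauge_right_sub_gauge_advance_left χ hx]
  simp

/-- The chain with given coordinates. -/
def ofGauge (v : Fin S.n × Side → ℤ) (a : S.Arc) : ℤ := χ.arcSgn a * v (χ.enter.symm a)

theorem gauge_ofGauge (v : Fin S.n × Side → ℤ) : χ.gauge (χ.ofGauge v) = v := by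
  funext p
  have : χ.arcSgn (χ.enter p) = χ.arcSgn p := by rw [arcSgn, k_enter, arcSgn]
  have h1 := χ.arcSgn_mul_self (R := ℤ) p
  rw [gauge, ofGauge, this, Equiv.symm_apply_apply]
  simp only [Int.cast_id] at h1 ⊢
  rw [← mul_assoc, h1, one_mul]

/-- The vectors on which all conservation laws hold are the coordinates of the cycles that vanish
at the exceptional entry. -/
theorem ofGauge_isCycle (c₀ : Fin S.n) (w : Fin S.n → Fin S.n × Side → ℤ)
    {v : Fin S.n × Side → ℤ} (hv : ∀ c, (χ.flowMatrix c₀ w).mulVec v (c, .left) = 0)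
    (c : Fin S.n) :
    χ.ofGauge v (S.inArc c .left) + χ.ofGauge v (S.inArc c .right) =
      χ.ofGauge v (S.outArc c .left) + χ.ofGauge v (S.outArc c .right) := by
  have hsum : ∑ p, v (χ.advance p) = ∑ p, v p := Equiv.sum_comp χ.advance v
  have hv0 : v (c₀, .left) = 0 := by
    have h := Finset.sum_eq_zero fun c (_ : c ∈ Finset.univ) => hv c
    simp only [flowMatrix_mulVec_left] at h
    rw [Finset.sum_add_distrib, Finset.sum_ite_eq'] at h
    rw [Fintype.sum_prod_type, Fintype.sum_prod_type, ← sub_eq_zero, ← Finset.sum_sub_distrib]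
      at hsum
    simp only [Side.sum_eq] at hsum
    have : ∑ c, (v (c, .left) - v (χ.advance (c, .left)) +
        (v (c, .right) - v (χ.advance (c, .right)))) = 0 := by
      rw [← neg_eq_zero, ← hsum, ← Finset.sum_neg_distrib]
      refine Finset.sum_congr rfl fun c _ => ?_
      ring
    simpa [this] using h
  have h := hv c
  have hl := χ.gauge_sub_gauge_advance (χ.ofGauge v) c .left
  have hr := χ.gauge_sub_gauge_advance (χ.ofGauge v) c .right
  rw [gauge_ofGauge] at hl hr
  rw [flowMatrix_mulVec_left, hl, hr, hv0] at h
  simp only [ite_self] at h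
  linear_combination h

end Checkerboard

end LinkShadow

namespace LinkDiagram

open LinkShadow

variable {D : LinkDiagram}

/-! ### The symmetrized Seifert form -/

/-- The sign of a crossing, as an integer. -/
def crossingSgn (D : LinkDiagram) (c : Fin D.n) : ℤ := if D.positive c then 1 else -1

theorem mem_cycles_iff {x : D.Arc → ℤ} : x ∈ D.cycles ↔
    ∀ c, x (D.inArc c .left) + x (D.inArc c .right) =
      x (D.outArc c .left) + x (D.outArc c .right) := Iff.rfl

theorem mem_seifertCircles_iff {x : D.cycles} :
    x ∈ D.seifertCircles ↔ ∀ c, D.leftFlow x.1 c = 0 := by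
  constructor
  · intro h c
    exact sub_eq_zero.2 (h c .right)
  · intro h c s
    have h1 : x.1 (D.inArc c .right) = x.1 (D.outArc c .right) := sub_eq_zero.1 (h c)
    have h2 := mem_cycles_iff.1 x.2 c
    cases s
    · linarith
    · exact h1

/-- The symmetrized Seifert form is a sum of local terms, in which the sign of the crossing only
appears in front of a form of rank one. -/
theorem linking_add_linking (hS : D.graphPieces = 1) (hn : 0 < D.n) (x y : D.cycles) :
    D.linking x y + D.linking y x =
      ∑ c, D.leftFlow y.1 c * (D.upFlow x.1 c - D.crossingSgn c * D.leftFlow x.1 c) := by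
  have hcast : ∀ z : D.cycles, (fun a => (z.1 a : ℚ)) ∈ LinearMap.ker (D.arcBoundary ℚ) :=
    fun z => mem_ker_arcBoundary.2 fun c => by
      have := mem_cycles_iff.1 z.2 c
      exact_mod_cast this
  have h1 := intersection_eq_zero hS hn D.planar (hcast x) (hcast y)
  norm_cast at h1
  -- Every arc starts at one crossing and ends at one crossing.
  have h2 : ∑ p : Fin D.n × Side, x.1 p * y.1 p =
      ∑ p, x.1 (D.next.symm p) * y.1 (D.next.symm p) :=
    (Equiv.sum_comp D.next.symm fun p => x.1 p * y.1 p).symm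
  rw [Fintype.sum_prod_type, Fintype.sum_prod_type, ← sub_eq_zero, ← Finset.sum_sub_distrib] at h2
  simp only [Side.sum_eq] at h2
  refine mul_left_cancel₀ (two_ne_zero (α := ℤ)) ?_
  rw [linking, linking, ← neg_add, ← Finset.sum_add_distrib, mul_neg, Finset.mul_sum,
    Finset.mul_sum, ← sub_eq_zero, ← Finset.sum_neg_distrib, ← Finset.sum_sub_distrib]
  have h3 : ∑ c, ((x.1 (c, .left) * y.1 (c, .left) + x.1 (c, .right) * y.1 (c, .right) -
      (x.1 (D.next.symm (c, .left)) * y.1 (D.next.symm (c, .left)) +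
        x.1 (D.next.symm (c, .right)) * y.1 (D.next.symm (c, .right)))) -
      ((x.1 (D.inArc c .left) + x.1 (D.inArc c .right)) *
        (y.1 (D.outArc c .right) - y.1 (D.inArc c .right)) -
      (y.1 (D.inArc c .left) + y.1 (D.inArc c .right)) *
        (x.1 (D.outArc c .right) - x.1 (D.inArc c .right)))) = 0 := by
    rw [Finset.sum_sub_distrib, h1, h2, sub_zero]
  rw [← neg_eq_zero, ← Finset.sum_neg_distrib]
  refine Eq.trans (Finset.sum_congr rfl fun c _ => ?_) h3
  have hx : x.1 (c, .left) = x.1 (D.inArc c .left) + x.1 (D.inArc c .right) - x.1 (c, .right) :=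
    eq_sub_of_add_eq (mem_cycles_iff.1 x.2 c).symm
  have hy : y.1 (c, .left) = y.1 (D.inArc c .left) + y.1 (D.inArc c .right) - y.1 (c, .right) :=
    eq_sub_of_add_eq (mem_cycles_iff.1 y.2 c).symm
  rw [hx, hy]
  simp only [bandFlow, leftFlow, upFlow, crossingSgn, outArc, inArc]
  split_ifs <;> ring

end LinkDiagram

namespace LinkDiagram

open LinkShadow

variable {D : LinkDiagram}

/-! ### The homology of the Seifert surface in a state with a single circle -/

/-- A cycle that respects the smoothings of a state with a single circle is a multiple of this
circle, so that it is zero as soon as it vanishes on one arc. -/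
theorem eq_zero_of_state (χ : D.toLinkShadow.Checkerboard) {o : Fin D.n → Bool}
    (ho : D.circuits o = 1) {x : D.Arc → ℚ}
    (hx : ∀ c, x (D.inArc c .left) + x (D.inArc c .right) =
      x (D.outArc c .left) + x (D.outArc c .right))
    (h1 : ∀ c, o c = true → D.leftFlow x c = 0) (h2 : ∀ c, o c = false → D.upFlow x c = 0)
    (a : D.Arc) (ha : x a = 0) : x = 0 := by
  have hstep : ∀ p, χ.gauge x p = χ.gauge x (χ.walk o p) := by
    rintro ⟨c, s⟩
    rw [χ.walk_apply]
    have hl := χ.gauge_sub_gauge_advance x c .left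
    have hr := χ.gauge_sub_gauge_advance x c .right
    cases hoc : o c
    · have h3 := χ.gauge_right_sub_gauge_advance_left (hx c)
      rw [h2 c hoc, mul_zero] at h3
      have hxc := hx c
      cases s
      · simp only [Bool.false_eq_true, if_false, Side.other_left]
        linear_combination hl + hr - h3 + hxc
      · simp only [Bool.false_eq_true, if_false, Side.other_right]
        linear_combination h3
    · have h3 : x (D.inArc c .right) - x (D.outArc c .right) = 0 := h1 c hoc
      have hxc := hx c
      cases s
      · simp only [if_true]
        linear_combination hl + hxc - h3
      · simp only [if_true]
        linear_combination hr + h3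
  rw [χ.circuits_eq_orbitCount] at ho
  have hconst : ∀ p q, χ.gauge x p = χ.gauge x q := by
    intro p q
    have := (Nat.card_eq_one_iff_unique.1 ho).1
    have hlift : ∀ p q, χ.walk o p = q → χ.gauge x p = χ.gauge x q := by
      rintro p _ rfl
      exact hstep p
    exact congrArg (Quot.lift (χ.gauge x) hlift) (Subsingleton.elim (Quot.mk _ p) (Quot.mk _ q))
  funext b
  have h := hconst (χ.enter.symm b) (χ.enter.symm a)
  simp only [Checkerboard.gauge, Equiv.apply_symm_apply, ha, mul_zero] at h
  have hne : (χ.arcSgn (χ.enter.symm b) : ℚ) ≠ 0 := fun h0 => by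
    have := χ.arcSgn_mul_self (R := ℚ) (χ.enter.symm b)
    simp [h0] at this
  exact (mul_eq_zero.1 h).resolve_left hne

/-- If a state with a single circle arises from the Seifert circles by as few changes as possible,
i.e. if the changed crossings form a spanning tree of the Seifert graph, then a cycle that
runs through none of the other bands runs through no band at all. -/
theorem leftFlow_eq_zero_of_state (χ : D.toLinkShadow.Checkerboard) {o : Fin D.n → Bool}
    (ho : D.circuits o = 1)
    (hk : D.circuits (fun _ => true) = 1 + (Finset.univ.filter fun c => o c = false).card)
    {x : D.Arc → ℤ} (hx : x ∈ D.cycles) (h : ∀ c, o c = true → D.leftFlow x c = 0)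
    (c : Fin D.n) : D.leftFlow x c = 0 := by
  classical
  -- The rational versions of both spaces of cycles have the same dimension.
  let V : Submodule ℚ (D.Arc → ℚ) :=
    { carrier := {x | ∀ c s, x (D.inArc c s) = x (D.outArc c s)}
      add_mem' := by intro x y hx hy c s; simp [hx c s, hy c s]
      zero_mem' := by intro c s; simp
      smul_mem' := by intro t x hx c s; simp [hx c s] }
  let W : Submodule ℚ (D.Arc → ℚ) := LinearMap.ker (D.arcBoundary ℚ) ⊓
    { carrier := {x | ∀ c, o c = true → x (D.inArc c .right) = x (D.outArc c .right)}
      add_mem' := by intro x y hx hy c hc; simp [hx c hc, hy c hc]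
      zero_mem' := by intro c hc; simp
      smul_mem' := by intro t x hx c hc; simp [hx c hc] }
  have hVW : V ≤ W := by
    intro x hx
    exact ⟨mem_ker_arcBoundary.2 fun c => by rw [hx c .left, hx c .right],
      fun c _ => hx c .right⟩
  have hV : D.circuits (fun _ => true) ≤ Module.finrank ℚ V := by
    have : Fintype (Quot (D.Smoothed fun _ => true)) := Fintype.ofFinite _
    let f : (Quot (D.Smoothed fun _ => true) → ℚ) →ₗ[ℚ] V :=
      { toFun := fun u => ⟨fun a => u (Quot.mk _ a), fun c s =>
          congrArg u (Quot.sound (Smoothed.oriented c s rfl))⟩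
        map_add' := fun u v => rfl
        map_smul' := fun t u => rfl }
    have hf : Function.Injective f := by
      intro u v huv
      funext q
      obtain ⟨a⟩ := q
      exact congrFun (congrArg Subtype.val huv) a
    have := LinearMap.finrank_le_finrank_of_injective hf
    rwa [Module.finrank_fintype_fun_eq_card, ← Nat.card_eq_fintype_card] at this
  have hW : Module.finrank ℚ W ≤ 1 + (Finset.univ.filter fun c => o c = false).card := by
    let a₀ : D.Arc := (c, .left)
    let f : W →ₗ[ℚ] ℚ × ({c // o c = false} → ℚ) :=
      { toFun := fun x => (x.1 a₀, fun c => D.upFlow x.1 c)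
        map_add' := fun x y => by
          ext
          · simp
          · simp [upFlow]; ring
        map_smul' := fun t x => by
          ext
          · simp
          · simp [upFlow]; ring }
    have hf : Function.Injective f := by
      rw [← LinearMap.ker_eq_bot, LinearMap.ker_eq_bot']
      intro x hx
      refine Subtype.ext (eq_zero_of_state χ ho (mem_ker_arcBoundary.1 x.2.1) ?_ ?_ a₀
        (congrArg Prod.fst hx))
      · intro c hc
        exact sub_eq_zero.2 (x.2.2 c hc)
      · intro c hc
        exact congrFun (congrArg Prod.snd hx) ⟨c, hc⟩
    have := LinearMap.finrank_le_finrank_of_injective hf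
    rwa [Module.finrank_prod, Module.finrank_self, Module.finrank_fintype_fun_eq_card,
      Fintype.card_subtype] at this
  have hEq : V = W := Submodule.eq_of_le_of_finrank_le hVW (by omega)
  have hxW : (fun a => (x a : ℚ)) ∈ W := by
    refine ⟨mem_ker_arcBoundary.2 fun c => ?_, fun c hc => ?_⟩
    · exact_mod_cast mem_cycles_iff.1 hx c
    · exact congrArg (Int.cast : ℤ → ℚ) (sub_eq_zero.1 (h c hc))
  rw [← hEq] at hxW
  have hxc : (x (D.inArc c .right) : ℚ) = x (D.outArc c .right) := hxW c .right
  exact sub_eq_zero.2 (Int.cast_injective hxc)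

/-- A state with a single circle has a dual basis of cycles, by unimodularity. In this
basis, `flowMatrix` becomes an `n × n` matrix. -/
theorem exists_dual_cycles (χ : D.toLinkShadow.Checkerboard) (hn : 0 < D.n) {o : Fin D.n → Bool}
    (ho : D.circuits o = 1) :
    ∃ z : Fin D.n → D.cycles,
      (∀ c c', o c = true → D.leftFlow (z c').1 c = if c = c' then 1 else 0) ∧
      (∀ c c', o c = false →
        χ.arcSgn (c, .right) * D.upFlow (z c').1 c = if c = c' then 1 else 0) ∧
      ∀ t : Fin D.n → ℤ, (Matrix.of fun c c' => t c * D.leftFlow (z c').1 c +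
        χ.arcSgn (c, .right) * D.upFlow (z c').1 c).det =
          ∑ o : Fin D.n → Bool with D.circuits o = 1, ∏ c with o c = true, t c := by
  let c₀ : Fin D.n := ⟨0, hn⟩
  let N := χ.flowMatrix c₀ (χ.stateRow o)
  have hN : N.det = 1 := by
    rw [χ.det_flowMatrix_stateRow, if_pos ho]
  have hNinv : N * N⁻¹ = 1 := Matrix.mul_nonsing_inv _ (by rw [hN]; exact isUnit_one)
  let v : Fin D.n → Fin D.n × Side → ℤ := fun c p => N⁻¹ p (c, .right)
  have hv : ∀ c, N.mulVec (v c) = Pi.single (c, .right) 1 := by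
    intro c
    ext p
    have := congrFun (congrFun hNinv p) (c, Side.right)
    rw [Matrix.mul_apply] at this
    rw [Pi.single_apply]
    simpa [Matrix.mulVec, dotProduct, Matrix.one_apply] using this
  have hcyc : ∀ c, χ.ofGauge (v c) ∈ D.cycles := by
    intro c
    refine mem_cycles_iff.2 (χ.ofGauge_isCycle c₀ (χ.stateRow o) fun c' => ?_)
    have := congrFun (hv c) (c', .left)
    simpa using this
  have hrow : ∀ c c', χ.stateRow o c ⬝ᵥ v c' = if c = c' then 1 else 0 := by
    intro c c'
    have := congrFun (hv c') (c, .right)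
    rw [χ.flowMatrix_mulVec_right] at this
    rw [this, Pi.single_apply]
    simp
  have hor : ∀ c c', χ.orientedRow c ⬝ᵥ v c' = D.leftFlow (χ.ofGauge (v c')) c := by
    intro c c'
    rw [← χ.orientedRow_dotProduct, χ.gauge_ofGauge]
  have hun : ∀ c c', χ.unorientedRow c ⬝ᵥ v c' =
      χ.arcSgn (c, .right) * D.upFlow (χ.ofGauge (v c')) c := by
    intro c c'
    rw [← χ.unorientedRow_dotProduct (mem_cycles_iff.1 (hcyc c') c), χ.gauge_ofGauge]
  refine ⟨fun c => ⟨χ.ofGauge (v c), hcyc c⟩, fun c c' hc => ?_, fun c c' hc => ?_, fun t => ?_⟩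
  · rw [← hor, ← hrow, Checkerboard.stateRow, if_pos hc]
  · rw [← hun, ← hrow, Checkerboard.stateRow, if_neg (by simp [hc])]
  · rw [← χ.det_flowMatrix c₀]
    have hNi : (N⁻¹).det = 1 := by
      have := congrArg Matrix.det hNinv
      rwa [Matrix.det_mul, hN, one_mul, Matrix.det_one] at this
    let w : Fin D.n → Fin D.n × Side → ℤ := fun c => t c • χ.orientedRow c + χ.unorientedRow c
    let P := χ.flowMatrix c₀ w * N⁻¹
    have hleft : ∀ c p, P (c, .left) p = (1 : Matrix _ _ ℤ) (c, Side.left) p := fun c p =>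
      congrFun (congrFun hNinv (c, Side.left)) p
    have hright : ∀ c c', P (c, .right) (c', .right) = t c * D.leftFlow (χ.ofGauge (v c')) c +
        χ.arcSgn (c, .right) * D.upFlow (χ.ofGauge (v c')) c := by
      intro c c'
      rw [← hor, ← hun, ← smul_eq_mul, ← smul_dotProduct, ← add_dotProduct]
      rfl
    have hP : P.det = (χ.flowMatrix c₀ w).det := by rw [Matrix.det_mul, hNi, mul_one]
    change _ = (χ.flowMatrix c₀ w).det
    rw [← hP, Matrix.twoBlockTriangular_det P (fun p => p.2 = .right)]
    · have h1 : P.toSquareBlockProp (fun p => ¬ p.2 = .right) = 1 := by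
        ext ⟨⟨c, s⟩, hs⟩ ⟨⟨c', s'⟩, hs'⟩
        dsimp only at hs hs'
        cases s
        · exact (hleft c _).trans (by simp [Matrix.one_apply])
        · exact absurd rfl hs
      let e : Fin D.n ≃ {p : Fin D.n × Side // p.2 = .right} :=
        { toFun := fun c => ⟨(c, .right), rfl⟩
          invFun := fun p => p.1.1
          left_inv := fun c => rfl
          right_inv := fun ⟨⟨c, s⟩, hs⟩ => by
            dsimp only at hs
            subst hs
            rfl }
      rw [h1, Matrix.det_one, mul_one, ← Matrix.det_submatrix_equiv_self e]
      congr 1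
      ext c c'
      exact (hright c c').symm
    · rintro ⟨c, s⟩ hs ⟨c', s'⟩ hs'
      dsimp only at hs hs'
      cases s
      · rw [hleft, Matrix.one_apply_ne]
        intro h
        exact hs ((congrArg Prod.snd h).trans hs')
      · exact absurd rfl hs

/-- The bands that are cut in a minimal state with a single circle give coordinates on the
homology of the Seifert surface, and the dual cycles are a basis. -/
theorem exists_basis (χ : D.toLinkShadow.Checkerboard) {o : Fin D.n → Bool}
    (ho : D.circuits o = 1)
    (hk : D.circuits (fun _ => true) = 1 + (Finset.univ.filter fun c => o c = false).card)
    {z : Fin D.n → D.cycles}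
    (hz : ∀ c c', o c = true → D.leftFlow (z c').1 c = if c = c' then 1 else 0) :
    ∃ b : Module.Basis {c // o c = true} ℤ D.SurfaceHomology,
      ∀ (x : D.cycles) c, b.repr (D.seifertCircles.mkQ x) c = D.leftFlow x.1 c := by
  let f : D.cycles →ₗ[ℤ] ({c // o c = true} → ℤ) :=
    { toFun := fun x c => D.leftFlow x.1 c
      map_add' := fun x y => by ext c; simp [leftFlow]; ring
      map_smul' := fun t x => by ext c; simp [leftFlow]; ring }
  have hker : D.seifertCircles = LinearMap.ker f := by
    ext x
    rw [mem_seifertCircles_iff, LinearMap.mem_ker]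
    constructor
    · intro h
      funext c
      exact h c
    · intro h c
      exact leftFlow_eq_zero_of_state χ ho hk x.2 (fun c hc => congrFun h ⟨c, hc⟩) c
  have hsurj : Function.Surjective f := by
    intro u
    refine ⟨∑ c, u c • z c, ?_⟩
    rw [map_sum]
    funext c
    simp only [map_smul, Finset.sum_apply, Pi.smul_apply, smul_eq_mul]
    rw [Finset.sum_eq_single c]
    · have := hz c c c.2
      rw [if_pos rfl] at this
      change u c * D.leftFlow (z c).1 c = u c
      rw [this, mul_one]
    · intro c' _ hc'
      have := hz c c' c.2
      rw [if_neg fun h => hc' (Subtype.ext h.symm)] at this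
      change u c' * D.leftFlow (z c').1 c = 0
      rw [this, mul_zero]
    · simp
  refine ⟨Module.Basis.ofEquivFun ((Submodule.quotEquivOfEq _ _ hker).trans
    (f.quotKerEquivOfSurjective hsurj)), fun x c => ?_⟩
  rfl

/-- The determinant of the symmetrized Seifert form as a state sum. -/
theorem det_linking_add_linking (χ : D.toLinkShadow.Checkerboard) (hS : D.graphPieces = 1)
    (hn : 0 < D.n) {o : Fin D.n → Bool} (ho : D.circuits o = 1)
    (hk : D.circuits (fun _ => true) = 1 + (Finset.univ.filter fun c => o c = false).card)
    {g : ℕ} (b : Module.Basis (Fin g) ℤ D.SurfaceHomology) (γ : Fin g → D.cycles)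
    (hγ : ∀ i, D.seifertCircles.mkQ (γ i) = b i) :
    g = (Finset.univ.filter fun c => o c = true).card ∧
    (Matrix.of fun i j => D.linking (γ i) (γ j) + D.linking (γ j) (γ i)).det =
      (∏ c with o c = true, -χ.sgn c) *
        ∑ o : Fin D.n → Bool with D.circuits o = 1,
          ∏ c with o c = true, χ.sgn c * D.crossingSgn c := by
  classical
  obtain ⟨z, hz1, hz2, hz3⟩ := exists_dual_cycles χ hn ho
  obtain ⟨b', hb'⟩ := exists_basis χ ho hk hz1
  have hcard : g = (Finset.univ.filter fun c => o c = true).card := by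
    have := Fintype.card_congr (b.indexEquiv b')
    rwa [Fintype.card_fin, Fintype.card_subtype] at this
  refine ⟨hcard, ?_⟩
  -- The dual cycles of the edges of the spanning tree are combinations of Seifert circles.
  have hzero : ∀ c, o c = false → ∀ c', D.leftFlow (z c).1 c' = 0 := fun c hc =>
    leftFlow_eq_zero_of_state χ ho hk (z c).2 fun c' hc' => by
      rw [hz1 c' c hc', if_neg]
      rintro rfl
      simp [hc] at hc'
  let B : D.cycles → D.cycles → ℤ := fun x y => D.linking x y + D.linking y x
  have hB : ∀ x y, B x y = ∑ c, (χ.arcSgn (c, .right) * D.leftFlow y.1 c) *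
      ((χ.sgn c * D.crossingSgn c) * D.leftFlow x.1 c +
        χ.arcSgn (c, .right) * D.upFlow x.1 c) := by
    intro x y
    rw [show B x y = _ from linking_add_linking hS hn x y]
    refine Finset.sum_congr rfl fun c _ => ?_
    have h := χ.sgn_mul_self c
    rw [χ.arcSgn_right]
    linear_combination (-(D.leftFlow y.1 c * (D.upFlow x.1 c -
      D.crossingSgn c * D.leftFlow x.1 c))) * h
  have hsymm : ∀ x y, B x y = B y x := fun x y => add_comm _ _
  have hB0 : ∀ x y, (∀ c, D.leftFlow y.1 c = 0) → B x y = 0 := by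
    intro x y hy
    rw [hB]
    exact Finset.sum_eq_zero fun c _ => by rw [hy c, mul_zero, zero_mul]
  -- The Gram matrix of the dual basis arises from the matrix of `exists_dual_cycles` by the
  -- multiplication with a block triangular matrix `H`.
  let M : Matrix {c // o c = true} {c // o c = true} ℤ := Matrix.of fun c c' => B (z c') (z c)
  have hM : M.det = (∏ c with o c = true, -χ.sgn c) *
      ∑ o : Fin D.n → Bool with D.circuits o = 1,
        ∏ c with o c = true, χ.sgn c * D.crossingSgn c := by
    let t : Fin D.n → ℤ := fun c => χ.sgn c * D.crossingSgn c
    let G : Matrix (Fin D.n) (Fin D.n) ℤ := Matrix.of fun c c' =>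
      t c * D.leftFlow (z c').1 c + χ.arcSgn (c, .right) * D.upFlow (z c').1 c
    let H : Matrix (Fin D.n) (Fin D.n) ℤ := Matrix.of fun c c' =>
      if o c = true then χ.arcSgn (c', .right) * D.leftFlow (z c).1 c'
      else if c = c' then 1 else 0
    have hH : H.det = ∏ c with o c = true, -χ.sgn c := by
      rw [Matrix.twoBlockTriangular_det H (fun c => o c = true)]
      · have h1 : H.toSquareBlockProp (fun c => o c = true) =
            Matrix.diagonal fun c : {c // o c = true} => -χ.sgn c.1 := by
          ext ⟨c, hc⟩ ⟨c', hc'⟩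
          have := hz1 c' c hc'
          change (if o c = true then χ.arcSgn (c', .right) * D.leftFlow (z c).1 c'
            else if c = c' then 1 else 0) = _
          rw [if_pos hc, this, χ.arcSgn_right, Matrix.diagonal_apply]
          by_cases hcc : c = c'
          · subst hcc; simp
          · simp [hcc, Ne.symm hcc]
        have h2 : H.toSquareBlockProp (fun c => ¬ o c = true) = 1 := by
          ext ⟨c, hc⟩ ⟨c', hc'⟩
          change (if o c = true then χ.arcSgn (c', .right) * D.leftFlow (z c).1 c'
            else if c = c' then 1 else 0) = _
          rw [if_neg hc, Matrix.one_apply]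
          simp
        rw [h1, h2, Matrix.det_one, mul_one, Matrix.det_diagonal]
        exact (Finset.prod_subtype (Finset.univ.filter fun c => o c = true) (by simp)
          fun c => -χ.sgn c).symm
      · intro c hc c' hc'
        change (if o c = true then χ.arcSgn (c', .right) * D.leftFlow (z c).1 c'
          else if c = c' then 1 else 0) = 0
        rw [if_neg hc, if_neg]
        rintro rfl
        exact hc hc'
    have hHG1 : ∀ c c', o c = true → (H * G) c c' = B (z c') (z c) := by
      intro c c' hc
      rw [Matrix.mul_apply, hB]
      refine Finset.sum_congr rfl fun c₂ _ => ?_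
      change (if o c = true then χ.arcSgn (c₂, .right) * D.leftFlow (z c).1 c₂
        else if c = c₂ then 1 else 0) * _ = _
      rw [if_pos hc]
      rfl
    have hHG2 : ∀ c c', o c = false → (H * G) c c' = G c c' := by
      intro c c' hc
      rw [Matrix.mul_apply, Finset.sum_eq_single c]
      · simp [H, hc]
      · intro c₂ _ hc₂
        simp [H, hc, hc₂.symm]
      · simp
    have hHG : (H * G).det = M.det := by
      rw [Matrix.twoBlockTriangular_det (H * G) (fun c => o c = false)]
      · have h1 : (H * G).toSquareBlockProp (fun c => o c = false) = 1 := by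
          ext ⟨c, hc⟩ ⟨c', hc'⟩
          change (H * G) c c' = _
          rw [hHG2 c c' hc]
          change t c * D.leftFlow (z c').1 c + χ.arcSgn (c, .right) * D.upFlow (z c').1 c = _
          rw [hzero c' hc' c, hz2 c c' hc, Matrix.one_apply]
          simp
        let e : {c // o c = true} ≃ {c // ¬ o c = false} :=
          Equiv.subtypeEquivRight fun c => by simp
        rw [h1, Matrix.det_one, one_mul, ← Matrix.det_submatrix_equiv_self e]
        congr 1
        ext c c'
        exact hHG1 c c' c.2
      · intro c hc c' hc'
        rw [hHG1 c c' (by simpa using hc), hsymm, hB0 _ _ (hzero c' hc')]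
    rw [← hHG, Matrix.det_mul, hH]
    exact congrArg _ (hz3 t)
  rw [← hM]
  -- The change of basis.
  let e : Fin g ≃ {c // o c = true} := b.indexEquiv b'
  let P : Matrix {c // o c = true} {c // o c = true} ℤ := b'.toMatrix (b.reindex e)
  have hP : P.det * P.det = 1 := by
    have : IsUnit P.det := b'.isUnit_det (b.reindex e)
    exact Int.isUnit_mul_self this
  have hPγ : ∀ i c, P c (e i) = D.leftFlow (γ i).1 c := by
    intro i c
    rw [← hb', hγ]
    simp [P, Module.Basis.toMatrix_apply]
  have hgram : (Matrix.of fun i j => D.linking (γ i) (γ j) + D.linking (γ j) (γ i)) =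
      (P.transpose * M * P).submatrix e e := by
    have hexp : ∀ (y : D.cycles) c', D.leftFlow y.1 c' =
        ∑ c : {c // o c = true}, D.leftFlow y.1 c * D.leftFlow (z c).1 c' := by
      intro y c'
      have hlin : ∀ c', D.leftFlow (y - ∑ c : {c // o c = true}, D.leftFlow y.1 c • z c).1 c' =
          D.leftFlow y.1 c' - ∑ c : {c // o c = true},
            D.leftFlow y.1 c * D.leftFlow (z c).1 c' := by
        intro c'
        simp only [leftFlow, Submodule.coe_sub, Pi.sub_apply, Submodule.coe_sum,
          Submodule.coe_smul, Finset.sum_apply, Pi.smul_apply, smul_eq_mul, mul_sub,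
          Finset.sum_sub_distrib]
        ring
      rw [← sub_eq_zero, ← hlin]
      refine leftFlow_eq_zero_of_state χ ho hk (Subtype.property _) (fun c hc => ?_) c'
      rw [hlin, Finset.sum_eq_single ⟨c, hc⟩]
      · rw [hz1 c c hc, if_pos rfl, mul_one, sub_self]
      · intro c₂ _ hc₂
        rw [hz1 c c₂ hc, if_neg, mul_zero]
        rintro rfl
        exact hc₂ rfl
      · simp
    have hexpB : ∀ x y, B x y = ∑ c : {c // o c = true}, D.leftFlow y.1 c * B x (z c) := by
      intro x y
      simp only [hB, Finset.mul_sum]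
      rw [Finset.sum_comm]
      refine Finset.sum_congr rfl fun c' _ => ?_
      rw [hexp y c', Finset.mul_sum, Finset.sum_mul]
      refine Finset.sum_congr rfl fun c _ => ?_
      ring
    ext i j
    change B (γ i) (γ j) = _
    rw [Matrix.submatrix_apply, Matrix.mul_apply, hexpB]
    refine Finset.sum_congr rfl fun c' _ => ?_
    rw [Matrix.mul_apply, hsymm, hexpB, hPγ, Finset.sum_mul, Finset.mul_sum]
    refine Finset.sum_congr rfl fun c _ => ?_
    rw [Matrix.transpose_apply, hPγ]
    change _ = D.leftFlow (γ i).1 c * B (z c') (z c) * _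
    ring
  rw [hgram, Matrix.det_submatrix_equiv_self, Matrix.det_mul, Matrix.det_mul,
    Matrix.det_transpose]
  linear_combination M.det * hP

end LinkDiagram

/-! ### The signature and the phase of the determinant -/

theorem I_mul_ofReal_eq (r : ℝ) :
    Complex.I * (r : ℂ) = Complex.I ^ ((if 0 < r then 1 else 0) - (if r < 0 then 1 else 0) : ℤ) *
      ((|r| : ℝ) : ℂ) := by
  rcases lt_trichotomy r 0 with h | rfl | h
  · simp [h, not_lt.2 h.le, abs_of_neg h]
  · simp
  · simp [h, not_lt.2 h.le, abs_of_pos h]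

theorem neg_I_mul_ofReal_eq (r : ℝ) :
    -Complex.I * (r : ℂ) =
      Complex.I ^ (-((if 0 < r then 1 else 0) - (if r < 0 then 1 else 0)) : ℤ) *
        ((|r| : ℝ) : ℂ) := by
  rcases lt_trichotomy r 0 with h | rfl | h
  · simp [h, not_lt.2 h.le, abs_of_neg h]
  · simp
  · simp [h, not_lt.2 h.le, abs_of_pos h]

theorem prod_zpow_eq_zpow_sum {ι : Type*} (s : Finset ι) {z : ℂ} (hz : z ≠ 0) (f : ι → ℤ) :
    ∏ i ∈ s, z ^ f i = z ^ ∑ i ∈ s, f i := by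
  classical
  induction s using Finset.induction_on with
  | empty => simp
  | insert i s hi ih => rw [Finset.prod_insert hi, Finset.sum_insert hi, zpow_add₀ hz, ih]

/-- The sign of the determinant of a symmetric matrix is determined by its size and its
signature: every positive eigenvalue contributes a factor `I`, every negative one a
factor `I⁻¹ = I * (-1)`. -/
theorem I_pow_mul_det {g : ℕ} (M : Matrix (Fin g) (Fin g) ℤ) (hM : M.IsSymm) :
    Complex.I ^ g * (M.det : ℂ) = Complex.I ^ matrixSignature M * ((|M.det| : ℤ) : ℂ) ∧
    (-Complex.I) ^ g * (M.det : ℂ) = Complex.I ^ (-matrixSignature M) * ((|M.det| : ℤ) : ℂ) := by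
  let A : Matrix (Fin g) (Fin g) ℝ := M.map fun a : ℤ => (a : ℝ)
  have hA : A.IsHermitian := by
    ext i j
    simp only [A, Matrix.conjTranspose_apply, Matrix.map_apply, star_trivial]
    rw [hM.apply]
  have hdet : (M.det : ℝ) = ∏ i, hA.eigenvalues i := by
    have h1 : A.det = ∏ i, hA.eigenvalues i := by simpa using hA.det_eq_prod_eigenvalues
    rw [← h1]
    exact Int.cast_det M
  have habs : ((|M.det| : ℤ) : ℝ) = ∏ i, |hA.eigenvalues i| := by
    rw [Int.cast_abs, hdet, Finset.abs_prod]
  have hsig : matrixSignature M = ∑ i, ((if 0 < hA.eigenvalues i then 1 else 0) -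
      (if hA.eigenvalues i < 0 then 1 else 0) : ℤ) := by
    have hroots : A.charpoly.roots = Multiset.map hA.eigenvalues Finset.univ.val := by
      rw [hA.roots_charpoly_eq_eigenvalues]
      rfl
    have key : ∀ (p : ℝ → Prop) [DecidablePred p],
        ((A.charpoly.roots.countP p : ℕ) : ℤ) = ∑ i, if p (hA.eigenvalues i) then 1 else 0 := by
      intro p _
      rw [hroots, Multiset.countP_map, Finset.sum_boole]
      rfl
    rw [Finset.sum_sub_distrib, ← key fun r => 0 < r, ← key fun r => r < 0]
    rfl
  have hdetC : (M.det : ℂ) = ∏ i, (hA.eigenvalues i : ℂ) := by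
    rw [← Complex.ofReal_prod, ← hdet, Complex.ofReal_intCast]
  have habsC : ((|M.det| : ℤ) : ℂ) = ∏ i, ((|hA.eigenvalues i| : ℝ) : ℂ) := by
    rw [← Complex.ofReal_prod, ← habs, Complex.ofReal_intCast]
  have hpow : ∀ z : ℂ, z ^ g = ∏ _i : Fin g, z := fun z => by simp
  constructor
  · rw [hpow, hdetC, habsC, hsig, ← prod_zpow_eq_zpow_sum _ Complex.I_ne_zero,
      ← Finset.prod_mul_distrib, ← Finset.prod_mul_distrib]
    exact Finset.prod_congr rfl fun i _ => I_mul_ofReal_eq _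
  · rw [hpow, hdetC, habsC, hsig, ← Finset.sum_neg_distrib,
      ← prod_zpow_eq_zpow_sum _ Complex.I_ne_zero,
      ← Finset.prod_mul_distrib, ← Finset.prod_mul_distrib]
    exact Finset.prod_congr rfl fun i _ => neg_I_mul_ofReal_eq _

theorem symmetrized_isSymm {g : ℕ} (A : Matrix (Fin g) (Fin g) ℤ) : (symmetrized A).IsSymm := by
  rw [Matrix.IsSymm, symmetrized, Matrix.transpose_add, Matrix.transpose_transpose, add_comm]

/-! ### Values at `t = -1` -/

open LaurentPolynomial in
theorem evalNegOne_T (k : ℤ) : evalNegOne (T k) = Complex.I ^ k := by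
  simp [evalNegOne]

theorem evalNegOne_alexander {g : ℕ} (A : Matrix (Fin g) (Fin g) ℤ) :
    evalNegOne (alexander A) = (-Complex.I) ^ g * ((symmetrized A).det : ℂ) := by
  let φ : LaurentPolynomial ℤ →+* ℂ :=
    LaurentPolynomial.eval₂ (Int.castRingHom ℂ) (Units.mk0 Complex.I Complex.I_ne_zero)
  change φ (Matrix.det _) = _
  have h : ((symmetrized A).map fun a : ℤ => (a : ℂ)).det = ((symmetrized A).det : ℂ) :=
    (Int.cast_det _).symm
  rw [RingHom.map_det, ← h]
  have hpow : (-Complex.I) ^ g = (-Complex.I) ^ Fintype.card (Fin g) := by simp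
  rw [hpow, ← Matrix.det_smul]
  congr 1
  ext i j
  simp [φ, symmetrized]
  ring

/-! ### S-equivalence -/

theorem symmetrized_congr {g : ℕ} (A P : Matrix (Fin g) (Fin g) ℤ) (hP : IsUnit P.det) :
    (symmetrized (P * A * P.transpose)).det = (symmetrized A).det := by
  have : symmetrized (P * A * P.transpose) = P * symmetrized A * P.transpose := by
    simp only [symmetrized, Matrix.transpose_mul, Matrix.transpose_transpose, Matrix.mul_add,
      Matrix.add_mul, Matrix.mul_assoc]
  rw [this, Matrix.det_mul, Matrix.det_mul, Matrix.det_transpose]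
  linear_combination (symmetrized A).det * Int.isUnit_mul_self hP

theorem symmetrized_transpose {g : ℕ} (A : Matrix (Fin g) (Fin g) ℤ) :
    symmetrized A.transpose = symmetrized A := by
  rw [symmetrized, symmetrized, Matrix.transpose_transpose, add_comm]

theorem symmetrized_reindex_fromBlocks {g h : ℕ} (A : Matrix (Fin g) (Fin g) ℤ)
    (B : Matrix (Fin g) (Fin h) ℤ) (C : Matrix (Fin h) (Fin g) ℤ) (E : Matrix (Fin h) (Fin h) ℤ) :
    symmetrized (Matrix.reindex finSumFinEquiv finSumFinEquiv (Matrix.fromBlocks A B C E)) =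
      Matrix.reindex finSumFinEquiv finSumFinEquiv (Matrix.fromBlocks (symmetrized A)
        (B + C.transpose) (C + B.transpose) (E + E.transpose)) := by
  ext i j
  simp only [symmetrized, Matrix.reindex_apply, Matrix.add_apply, Matrix.transpose_apply,
    Matrix.submatrix_apply]
  rcases finSumFinEquiv.symm i with i | i <;> rcases finSumFinEquiv.symm j with j | j <;> rfl

/-- The enlargement adds a hyperbolic plane to the symmetrized matrix, up to congruence. -/
theorem det_symmetrized_seifertEnlarge {g : ℕ} (A : Matrix (Fin g) (Fin g) ℤ) (ξ : Fin g → ℤ) :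
    (symmetrized (A.seifertEnlarge ξ)).det = -(symmetrized A).det := by
  let X : Matrix (Fin g) (Fin 2) ℤ := Matrix.of fun i => ![ξ i, 0]
  let K : Matrix (Fin 2) (Fin 2) ℤ := !![0, 1; 1, 0]
  let Z : Matrix (Fin 2) (Fin g) ℤ := Matrix.of ![fun _ => 0, ξ]
  have h1 : symmetrized (A.seifertEnlarge ξ) = Matrix.reindex finSumFinEquiv finSumFinEquiv
      (Matrix.fromBlocks (symmetrized A) X X.transpose K) := by
    have hK : (!![0, 1; 0, 0] + !![0, 1; 0, 0].transpose : Matrix (Fin 2) (Fin 2) ℤ) = K := by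
      ext i j
      fin_cases i <;> fin_cases j <;> rfl
    rw [Matrix.seifertEnlarge, symmetrized_reindex_fromBlocks, hK]
    simp [symmetrized, X]
  -- Column operations with the last column clear the block `X`.
  have h2 : Matrix.fromBlocks (symmetrized A) X X.transpose K *
      Matrix.fromBlocks 1 0 (-Z) 1 = Matrix.fromBlocks (symmetrized A) X 0 K := by
    have hXZ : X * Z = 0 := by
      ext i j
      simp [Matrix.mul_apply, X, Z, Fin.sum_univ_two]
    have hKZ : K * Z = X.transpose := by
      ext i j
      fin_cases i <;> simp [Matrix.mul_apply, X, K, Z, Fin.sum_univ_two]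
    rw [Matrix.fromBlocks_multiply]
    simp [Matrix.mul_neg, hXZ, hKZ]
  have h3 := congrArg Matrix.det h2
  rw [Matrix.det_mul, Matrix.det_fromBlocks_zero₁₂, Matrix.det_fromBlocks_zero₂₁, Matrix.det_one,
    Matrix.det_one, mul_one, mul_one] at h3
  rw [h1, Matrix.det_reindex_self, h3]
  simp [K, Matrix.det_fin_two]

/-- The determinant of the symmetrized Seifert matrix changes its sign with every enlargement, as
does a fourth root of unity to the power of the size. -/
theorem LinkDiagram.IsSeifertMatrix.phase_eq {D : LinkDiagram} (z v : ℂ) (hz : z ^ 2 = -1)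
    (h : ∀ (g : ℕ) (b : Module.Basis (Fin g) ℤ D.SurfaceHomology) (γ : Fin g → D.cycles),
      (∀ i, D.seifertCircles.mkQ (γ i) = b i) →
      z ^ (g + (D.pieces - 1)) * ((symmetrized (Matrix.reindex finSumFinEquiv finSumFinEquiv
        (Matrix.fromBlocks (Matrix.of fun i j => D.linking (γ i) (γ j)) 0 0
          (0 : Matrix (Fin (D.pieces - 1)) (Fin (D.pieces - 1)) ℤ)))).det : ℂ) = v)
    {g : ℕ} {A : Matrix (Fin g) (Fin g) ℤ} (hA : D.IsSeifertMatrix A) :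
    z ^ g * ((symmetrized A).det : ℂ) = v := by
  have enl : ∀ {g : ℕ} (A : Matrix (Fin g) (Fin g) ℤ) (ξ : Fin g → ℤ),
      z ^ (g + 2) * ((symmetrized (A.seifertEnlarge ξ)).det : ℂ) =
        z ^ g * ((symmetrized A).det : ℂ) := by
    intro g A ξ
    rw [det_symmetrized_seifertEnlarge, pow_add, hz]
    push_cast
    ring
  induction hA with
  | surface b γ hγ => exact h _ b γ hγ
  | baseChange A P hP _ ih => rw [symmetrized_congr A P hP, ih]
  | enlarge A ξ _ ih => rw [enl, ih]
  | reduce A ξ _ ih => rw [← enl A ξ, ih]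
  | enlargeTranspose A ξ _ ih => rw [symmetrized_transpose, enl, symmetrized_transpose, ih]
  | reduceTranspose A ξ _ ih =>
    rw [symmetrized_transpose, enl, symmetrized_transpose] at ih
    exact ih

namespace LinkDiagram

open LinkShadow

variable {D : LinkDiagram}

/-! ### The Jones polynomial at `t = -1` -/

theorem loops_eq (s : Fin D.n → Bool) :
    D.loops s = D.circuits (fun c => s c == D.positive c) + D.circles := by
  rw [loops, circuits]
  congr 1
  refine card_quot_congr ?_ ?_
  · rintro _ _ (⟨c, side, h⟩ | ⟨c, h⟩ | ⟨c, h⟩)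
    · exact Quot.sound (.oriented c side (by simpa using h))
    · exact Quot.sound (.lower c (by simpa using h))
    · exact Quot.sound (.upper c (by simpa using h))
  · rintro _ _ (⟨c, side, h⟩ | ⟨c, h⟩ | ⟨c, h⟩)
    · exact Quot.sound (.oriented c side (by simpa using h))
    · exact Quot.sound (.lower c (by simpa using h))
    · exact Quot.sound (.upper c (by simpa using h))

theorem pieces_le_loops (s : Fin D.n → Bool) : D.pieces ≤ D.loops s := by
  refine Nat.add_le_add_right (card_quot_le_of_imp ?_) _
  have hm : ∀ c s s', Quot.mk D.Meet (D.inArc c s) = Quot.mk D.Meet (D.outArc c s') :=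
    fun c s s' => Quot.sound (.across c s s')
  rintro _ _ (⟨c, side, h⟩ | ⟨c, h⟩ | ⟨c, h⟩)
  · exact hm c side side
  · exact Quot.sound (.below c)
  · exact (hm c .left .left).symm.trans (hm c .left .right)

theorem graphPieces_pos (hn : 0 < D.n) : 0 < D.graphPieces := by
  have : Nonempty (Quot D.Meet) := ⟨Quot.mk _ (⟨0, hn⟩, .left)⟩
  exact Finite.card_pos

theorem pieces_pos : 0 < D.pieces := by
  rw [pieces]
  rcases Nat.eq_zero_or_pos D.n with hn | hn
  · have := D.nonempty
    omega
  · have := D.graphPieces_pos hn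
    omega

/-- At `t = -1` a circle has the value zero, so that only the states with a single circle
contribute to the state sum. -/
theorem evalNegOne_jones : evalNegOne D.jones =
    (-1) ^ (D.numPos + D.numNeg) * Complex.I ^ ((D.numPos : ℤ) - 2 * (D.numNeg : ℤ)) *
      ∑ s : Fin D.n → Bool with D.loops s = 1, Complex.I ^ D.numB s := by
  let φ : LaurentPolynomial ℤ →+* ℂ :=
    LaurentPolynomial.eval₂ (Int.castRingHom ℂ) (Units.mk0 Complex.I Complex.I_ne_zero)
  have hT : ∀ k, φ (LaurentPolynomial.T k) = Complex.I ^ k := evalNegOne_T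
  change φ D.jones = _
  rw [jones, map_mul, map_mul, map_pow, map_neg, map_one, hT, map_sum, Finset.sum_filter]
  congr 1
  refine Finset.sum_congr rfl fun s _ => ?_
  have h0 : φ (-LaurentPolynomial.T 1 - LaurentPolynomial.T (-1)) = 0 := by
    rw [map_sub, map_neg, hT, hT]
    simp
  rw [map_mul, map_pow, h0, hT, zpow_natCast]
  have := (D.pieces_pos).trans_le (D.pieces_le_loops s)
  split_ifs with h
  · rw [h]; simp
  · rw [zero_pow (by omega), mul_zero]

theorem evalNegOne_jones_of_one_lt_pieces (h : 1 < D.pieces) : evalNegOne D.jones = 0 := by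
  rw [evalNegOne_jones, Finset.sum_eq_zero, mul_zero]
  intro s hs
  have h1 := D.pieces_le_loops s
  have h2 := (Finset.mem_filter.1 hs).2
  omega

/-- The contribution of a state with a single circle, compared with the term of the determinant
that belongs to it. -/
theorem I_pow_numB (χ : D.toLinkShadow.Checkerboard) (s o : Fin D.n → Bool)
    (hs : ∀ c, o c = (s c == D.positive c)) :
    Complex.I ^ D.numB s = Complex.I ^ D.numPos *
      Complex.I ^ (-∑ c with o c = true, χ.sgn c) *
        ((∏ c with o c = true, χ.sgn c * D.crossingSgn c : ℤ) : ℂ) := by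
  rw [← Finset.sum_neg_distrib, ← prod_zpow_eq_zpow_sum _ Complex.I_ne_zero, numB, numPos,
    ← Finset.prod_const, ← Finset.prod_const]
  push_cast
  simp only [Finset.prod_filter]
  rw [← Finset.prod_mul_distrib, ← Finset.prod_mul_distrib]
  refine Finset.prod_congr rfl fun c _ => ?_
  rw [hs c]
  cases h1 : s c <;> cases h2 : D.positive c <;> cases h3 : χ.k (c, .left) <;>
    simp [Checkerboard.sgn, crossingSgn, h2, h3]

theorem I_zpow_neg_sum_sgn (χ : D.toLinkShadow.Checkerboard) (o : Fin D.n → Bool) :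
    ((∏ c with o c = true, -χ.sgn c : ℤ) : ℂ) =
      Complex.I ^ (-∑ c with o c = true, χ.sgn c) *
        Complex.I ^ (-((Finset.univ.filter fun c => o c = true).card : ℤ)) := by
  rw [← Finset.sum_neg_distrib, ← prod_zpow_eq_zpow_sum _ Complex.I_ne_zero, zpow_neg,
    zpow_natCast, ← inv_pow, ← Finset.prod_const, ← Finset.prod_mul_distrib]
  push_cast
  refine Finset.prod_congr rfl fun c _ => ?_
  cases h3 : χ.k (c, .left) <;> simp [Checkerboard.sgn, h3]

/-- The parity of the number of components of a link. -/
theorem neg_one_pow_components (hc : D.circles = 0) :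
    (-1 : ℤ) ^ D.components = (-1) ^ D.circuits (fun _ => true) * (-1) ^ D.n := by
  have h1 : D.components =
      Equiv.Perm.orbitCount (D.next.trans (D.exchange fun _ => false)) := by
    rw [components, hc, add_zero]
    refine card_quot_congr ?_ ?_
    · rintro _ _ (⟨c⟩ | ⟨c⟩)
      · exact Quot.sound (by simp [exchange_apply, outArc])
      · exact Quot.sound (by simp [exchange_apply, outArc])
    · rintro a _ rfl
      rw [Equiv.trans_apply, exchange_apply]
      conv_lhs => rw [← D.inArc_next a]
      generalize D.next a = p
      obtain ⟨c, s⟩ := p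
      cases s
      · exact Quot.sound (.toRight c)
      · exact Quot.sound (.toLeft c)
  have h2 : D.circuits (fun _ => true) = D.next.orbitCount := by
    refine card_quot_congr ?_ ?_
    · rintro _ _ (⟨c, s, h⟩ | ⟨c, h⟩ | ⟨c, h⟩)
      · exact Quot.sound (by simp [outArc])
      · cases h
      · cases h
    · rintro a _ rfl
      have := Quot.sound (Smoothed.oriented (o := fun _ => true) (D.next a).1 (D.next a).2 rfl)
      rwa [inArc_next] at this
  rw [h1, h2, Equiv.Perm.neg_one_pow_orbitCount, Equiv.Perm.neg_one_pow_orbitCount,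
    Equiv.Perm.sign_trans]
  push_cast
  rw [sign_exchange]
  simp
  ring

/-- The value of the Jones polynomial at `t = -1` for a connected diagram with at least one
crossing, and the parity of the first Betti number of the Seifert surface. -/
theorem jones_eq_of_connected (hS : D.graphPieces = 1) (hc : D.circles = 0) (hn : 0 < D.n)
    {g : ℕ} (b : Module.Basis (Fin g) ℤ D.SurfaceHomology) (γ : Fin g → D.cycles)
    (hγ : ∀ i, D.seifertCircles.mkQ (γ i) = b i) :
    Complex.I ^ g * ((symmetrized (Matrix.of fun i j => D.linking (γ i) (γ j))).det : ℂ) =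
        evalNegOne D.jones ∧
      (-1 : ℤ) ^ (D.components - 1) = (-1) ^ g := by
  obtain ⟨χ⟩ := exists_checkerboard hS hn D.planar
  obtain ⟨o₁, ho₁, hk⟩ := χ.exists_circuits_eq_one hS hn
  obtain ⟨hg, hdet⟩ := det_linking_add_linking χ hS hn ho₁ hk b γ hγ
  have hcard : (Finset.univ.filter fun c => o₁ c = true).card +
      (Finset.univ.filter fun c => o₁ c = false).card = D.n := by
    have := Finset.card_filter_add_card_filter_not (s := Finset.univ) (fun c => o₁ c = true)
    simpa using this
  constructor
  · set h : ℤ := ∑ c with o₁ c = true, χ.sgn c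
    have hh : ∀ o : Fin D.n → Bool, D.circuits o = 1 → ∑ c with o c = true, χ.sgn c = h :=
      fun o ho => (χ.sum_sgn_eq hS D.planar o ho).trans (χ.sum_sgn_eq hS D.planar o₁ ho₁).symm
    set T : ℤ := ∑ o : Fin D.n → Bool with D.circuits o = 1,
      ∏ c with o c = true, χ.sgn c * D.crossingSgn c
    have hsum : ∑ s : Fin D.n → Bool with D.loops s = 1, Complex.I ^ D.numB s =
        Complex.I ^ D.numPos * Complex.I ^ (-h) * (T : ℂ) := by
      have hinv : Function.Involutive fun (s : Fin D.n → Bool) c => s c == D.positive c := by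
        intro s
        funext c
        cases h1 : s c <;> cases h2 : D.positive c <;> simp [h1, h2]
      rw [Finset.sum_filter, ← Equiv.sum_comp hinv.toPerm, ← Finset.sum_filter]
      simp only [T]
      push_cast
      rw [Finset.mul_sum]
      refine Finset.sum_congr ?_ fun o ho => ?_
      · refine Finset.filter_congr fun o _ => ?_
        rw [loops_eq, hc, add_zero]
        exact iff_of_eq (congrArg (fun o => D.circuits o = 1) (hinv o))
      · have ho' : D.circuits o = 1 := by
          have := (Finset.mem_filter.1 ho).2
          simpa using this
        refine (I_pow_numB χ (fun c => o c == D.positive c) o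
          fun c => (congrFun (hinv o) c).symm).trans ?_
        rw [hh o ho']
        push_cast
        rfl
    have hsymm : symmetrized (Matrix.of fun i j => D.linking (γ i) (γ j)) =
        Matrix.of fun i j => D.linking (γ i) (γ j) + D.linking (γ j) (γ i) := rfl
    rw [hsymm, hdet, evalNegOne_jones, hsum]
    have hphase : (-1 : ℂ) ^ (D.numPos + D.numNeg) *
        Complex.I ^ ((D.numPos : ℤ) - 2 * (D.numNeg : ℤ)) * Complex.I ^ D.numPos = 1 := by
      rw [← Complex.I_sq, ← pow_mul, ← zpow_natCast, ← zpow_natCast, ← zpow_add₀ Complex.I_ne_zero,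
        ← zpow_add₀ Complex.I_ne_zero,
        show ((2 * (D.numPos + D.numNeg) : ℕ) : ℤ) + ((D.numPos : ℤ) - 2 * (D.numNeg : ℤ)) +
          (D.numPos : ℤ) = ((4 * D.numPos : ℕ) : ℤ) by push_cast; ring,
        zpow_natCast, pow_mul, Complex.I_pow_four, one_pow]
    have hI : Complex.I ^ g * Complex.I ^ (-(g : ℤ)) = 1 := by
      rw [zpow_neg, zpow_natCast]
      exact mul_inv_cancel₀ (pow_ne_zero _ Complex.I_ne_zero)
    have hprod := I_zpow_neg_sum_sgn χ o₁
    rw [← hg] at hprod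
    rw [Int.cast_mul, hprod]
    linear_combination (Complex.I ^ (-h) * (T : ℂ)) * (hI - hphase)
  · have h1 := neg_one_pow_components hc
    have h2 : 0 < D.components := by
      have : Nonempty (Quot D.Straight) := ⟨Quot.mk _ (⟨0, hn⟩, .left)⟩
      exact Nat.add_pos_left Finite.card_pos _
    obtain ⟨m, hm⟩ : ∃ m, D.components = m + 1 := ⟨_, (Nat.sub_add_cancel h2).symm⟩
    have h3 : (-1 : ℤ) ^ (Finset.univ.filter fun c => o₁ c = false).card *
        (-1) ^ (Finset.univ.filter fun c => o₁ c = false).card = 1 := by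
      rw [← mul_pow]; norm_num
    have h4 : (-1 : ℤ) ^ D.n =
        (-1) ^ g * (-1) ^ (Finset.univ.filter fun c => o₁ c = false).card := by
      rw [← pow_add, hg, hcard]
    rw [hk, h4, hm, pow_succ, pow_add] at h1
    rw [hm, Nat.add_sub_cancel]
    linear_combination -h1 + (-1) ^ g * h3

/-- The value of the Jones polynomial at `t = -1` for the Seifert matrices of the surface `F`. -/
theorem jones_eq_of_surface
    {g : ℕ} (b : Module.Basis (Fin g) ℤ D.SurfaceHomology) (γ : Fin g → D.cycles)
    (hγ : ∀ i, D.seifertCircles.mkQ (γ i) = b i) (M : Matrix _ _ ℤ)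
    (hM : M = symmetrized (Matrix.reindex finSumFinEquiv finSumFinEquiv
        (Matrix.fromBlocks (Matrix.of fun i j => D.linking (γ i) (γ j)) 0 0
          (0 : Matrix (Fin (D.pieces - 1)) (Fin (D.pieces - 1)) ℤ)))) :
    Complex.I ^ (g + (D.pieces - 1)) * (M.det : ℂ) = evalNegOne D.jones ∧
      (-Complex.I) ^ (g + (D.pieces - 1)) * (M.det : ℂ) =
        (-1) ^ (D.components - 1) * evalNegOne D.jones := by
  have hdet : M.det = (symmetrized (Matrix.of fun i j => D.linking (γ i) (γ j))).det *
      (0 : Matrix (Fin (D.pieces - 1)) (Fin (D.pieces - 1)) ℤ).det := by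
    rw [hM, symmetrized_reindex_fromBlocks, Matrix.det_reindex_self]
    simp only [Matrix.transpose_zero, add_zero, Matrix.det_fromBlocks_zero₂₁]
  rcases Nat.lt_or_ge 1 D.pieces with hp | hp
  · have : Nonempty (Fin (D.pieces - 1)) := ⟨⟨0, by omega⟩⟩
    rw [hdet, Matrix.det_zero, evalNegOne_jones_of_one_lt_pieces hp]
    simp
  have hp1 : D.pieces = 1 := le_antisymm hp D.pieces_pos
  have : IsEmpty (Fin (D.pieces - 1)) := ⟨fun i => by have := i.2; omega⟩
  rw [hdet, Matrix.det_isEmpty (A := (0 : Matrix (Fin (D.pieces - 1)) _ ℤ)), mul_one,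
    show g + (D.pieces - 1) = g by omega]
  suffices Complex.I ^ g *
      ((symmetrized (Matrix.of fun i j => D.linking (γ i) (γ j))).det : ℂ) = evalNegOne D.jones ∧
      (-1 : ℤ) ^ (D.components - 1) = (-1) ^ g by
    obtain ⟨h1, h2⟩ := this
    have h3 : (-1 : ℂ) ^ (D.components - 1) = (-1) ^ g := by exact_mod_cast h2
    refine ⟨h1, ?_⟩
    rw [h3, ← h1, neg_pow]
    ring
  rw [pieces] at hp1
  rcases Nat.eq_zero_or_pos D.n with hn | hn
  · -- The diagram is a single circle without crossings.
    have : IsEmpty (Fin D.n) := by rw [hn]; infer_instance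
    have hc : D.circles = 1 := by
      have : D.graphPieces = 0 := Nat.card_of_isEmpty
      omega
    have hg : IsEmpty (Fin g) := ⟨fun i => b.ne_zero i (Subsingleton.elim _ _)⟩
    have hg0 : g = 0 := (Fintype.card_fin g).symm.trans (Fintype.card_eq_zero_iff.2 hg)
    have hcomp : D.components = 1 := by
      rw [components, hc, Nat.card_of_isEmpty]
    have hloops : ∀ s, D.loops s = 1 := fun s => by
      rw [loops, hc, Nat.card_of_isEmpty]
    rw [evalNegOne_jones, Matrix.det_isEmpty]
    simp [hg0, hcomp, hloops, numPos, numNeg, numB]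
  · have h := D.graphPieces_pos hn
    exact jones_eq_of_connected (by omega) (by omega) hn b γ hγ

end LinkDiagram

theorem proposition5p4 (D : LinkDiagram) {g : ℕ} (A : Matrix (Fin g) (Fin g) ℤ)
    (hA : D.IsSeifertMatrix A) :
    evalNegOne D.jones =
        Complex.I ^ matrixSignature (symmetrized A) * ((|(symmetrized A).det| : ℤ) : ℂ) ∧
    evalNegOne (alexander A) =
        Complex.I ^ (-matrixSignature (symmetrized A)) * ((|(symmetrized A).det| : ℤ) : ℂ) ∧
    evalNegOne D.jones = (-1) ^ (D.components - 1) * evalNegOne (alexander A) := by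
  have h1 : Complex.I ^ g * ((symmetrized A).det : ℂ) = evalNegOne D.jones :=
    hA.phase_eq _ _ Complex.I_sq fun g b γ hγ => (D.jones_eq_of_surface b γ hγ _ rfl).1
  have h2 : (-Complex.I) ^ g * ((symmetrized A).det : ℂ) =
      (-1) ^ (D.components - 1) * evalNegOne D.jones :=
    hA.phase_eq _ _ (by rw [neg_sq, Complex.I_sq]) fun g b γ hγ =>
      (D.jones_eq_of_surface b γ hγ _ rfl).2
  obtain ⟨h3, h4⟩ := I_pow_mul_det (symmetrized A) (symmetrized_isSymm A)
  refine ⟨h1.symm.trans h3, (evalNegOne_alexander A).trans h4, ?_⟩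
  rw [evalNegOne_alexander, h2, ← mul_assoc, ← mul_pow]
  norm_num
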